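/- For $n,m\ge 1$ let $G_{n,m}$ be the $n\times m$ grid graph (the Cartesian product of a path on $n$ vertices and a path on $m$ vertices). A set $S$ of vertices is dominating if every vertex is in $S$ or has a neighbour in $S$, and total dominating if every vertex has a neighbour in $S$; it is minimal (total) dominating if it is inclusionwise minimal among the (total) dominating sets. Let $D_{n,m}$, $T_{n,m}$, $M_{n,m}$ and $\mathit{MT}_{n,m}$ be the numbers of dominating, total dominating, minimal dominating and minimal total dominating sets of $G_{n,m}$, respectively. A real number $x$ is computable with rate $f$, where $f:\mathbb N\to\mathbb N$ is a computable function, if there is a Turing machine which, given an integer $n\ge 1$ in binary, outputs in at most $f(n)$ steps a rational number $r_n$ with $|x-r_n|\le 1/n$. **Theorem.** There are real numbers $\nu_{\mathrm D},\nu_{\mathrm T},\nu_{\mathrm M},\nu_{\mathrm{MT}}\ge 0$ (the growth rates) such that, as $n$ and $m$ both tend to infinity, $$D_{n,m}=\nu_{\mathrm D}^{\,nm+o(nm)},\quad T_{n,m}=\nu_{\mathrm T}^{\,nm+o(nm)},\quad M_{n,m}=\nu_{\mathrm M}^{\,nm+o(nm)},\quad \mathit{MT}_{n,m}=\nu_{\mathrm{MT}}^{\,nm+o(nm)},$$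 and each of $\nu_{\mathrm D},\nu_{\mathrm T},\nu_{\mathrm M},\nu_{\mathrm{MT}}$ is computable with rate $n\mapsto 2^{O(n^2)}$, that is, with some rate $f$ for which there is a constant $C$ with $f(n)\le 2^{Cn^2}$ for all sufficiently large $n$. -/

import Mathlib

namespace GridDomination

open Filter Asymptotics

/-- `S` is a dominating set of `G`: every vertex is in `S` or has a neighbour in `S`. -/
def IsDominating {V : Type*} (G : SimpleGraph V) (S : Set V) : Prop :=
  ∀ v, v ∈ S ∨ ∃ w ∈ S, G.Adj v w

/-- `S` is a total dominating set of `G`: every vertex (also those in `S`) has a neighbour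
in `S`. -/
def IsTotalDominating {V : Type*} (G : SimpleGraph V) (S : Set V) : Prop :=
  ∀ v, ∃ w ∈ S, G.Adj v w

/-- The grid graph with `n` lines and `m` columns: the Cartesian product of the path on `n`
vertices and the path on `m` vertices. -/
def grid (n m : ℕ) : SimpleGraph (Fin n × Fin m) :=
  SimpleGraph.boxProd (SimpleGraph.pathGraph n) (SimpleGraph.pathGraph m)

/-- The number of dominating sets of the `n × m` grid. -/
noncomputable def numD (n m : ℕ) : ℕ :=
  {S : Set (Fin n × Fin m) | IsDominating (grid n m) S}.ncard

/-- The number of total dominating sets of the `n × m` grid. -/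
noncomputable def numT (n m : ℕ) : ℕ :=
  {S : Set (Fin n × Fin m) | IsTotalDominating (grid n m) S}.ncard

/-- The number of (inclusionwise) minimal dominating sets of the `n × m` grid. -/
noncomputable def numM (n m : ℕ) : ℕ :=
  {S : Set (Fin n × Fin m) | Minimal (IsDominating (grid n m)) S}.ncard

/-- The number of (inclusionwise) minimal total dominating sets of the `n × m` grid. -/
noncomputable def numMT (n m : ℕ) : ℕ :=
  {S : Set (Fin n × Fin m) | Minimal (IsTotalDominating (grid n m)) S}.ncard

/-- `ν ≥ 0` is the asymptotic growth rate of the doubly indexed sequence `a`: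
`a n m = ν ^ (n m + o(n m))` when both `n` and `m` tend to infinity. -/
def HasGrowthRate (a : ℕ → ℕ → ℕ) (ν : ℝ) : Prop :=
  0 ≤ ν ∧ ∃ e : ℕ × ℕ → ℝ,
    e =o[(atTop : Filter (ℕ × ℕ))] (fun p : ℕ × ℕ => (p.1 : ℝ) * (p.2 : ℝ)) ∧
      ∀ᶠ p : ℕ × ℕ in atTop, (a p.1 p.2 : ℝ) = ν ^ ((p.1 : ℝ) * (p.2 : ℝ) + e p)

/-- The word over the alphabet `{0, 1, separator}` (`some false`, `some true`, `none`) which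
writes the fraction `a / b`: a sign bit, `|a|` in binary, the separator, and `b` in binary. -/
def encodeFraction (a : ℤ) (b : ℕ) : List (Option Bool) :=
  (some (decide (a < 0)) :: (Computability.encodeNat a.natAbs).map some) ++
    (none :: (Computability.encodeNat b).map some)

/-- The real number `x` is computable with rate `f`, where `f : ℕ → ℕ` is a computable function:
some Turing machine, on every positive integer `n` written in binary on its input tape, halts
after at most `f n` steps with, on its output tape, a fraction `a / b` such that
`|x - a / b| ≤ 1 / n`. -/
def ComputableWithRate (x : ℝ) (f : ℕ → ℕ) : Prop :=
  Computable f ∧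
    ∃ M : Turing.TM2ComputableAux Bool (Option Bool),
      ∀ n : ℕ, 1 ≤ n → ∃ (a : ℤ) (b : ℕ), 0 < b ∧ |x - (a : ℝ) / (b : ℝ)| ≤ 1 / (n : ℝ) ∧
        Nonempty (Turing.TM2OutputsInTime M.tm
          ((Computability.encodeNat n).map M.inputAlphabet.symm)
          (some ((encodeFraction a b).map M.outputAlphabet.symm)) (f n))

/-- `f n ≤ 2 ^ O(n ^ 2)` as `n` tends to infinity. -/
def IsTwoPowBigOSq (f : ℕ → ℕ) : Prop :=
  ∃ C : ℕ, ∀ᶠ n : ℕ in atTop, f n ≤ 2 ^ (C * n ^ 2)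

/-- The real number `x` is computable with rate `n ↦ 2 ^ O(n ^ 2)`. -/
def ComputableWithRateTwoPowBigOSq (x : ℝ) : Prop :=
  ∃ f : ℕ → ℕ, IsTwoPowBigOSq f ∧ ComputableWithRate x f

end GridDomination

/-!
The four problems are treated at once: `Sol t k A S` says that `S` is a dominating set (total if `t`)
of a finite region `A` of the lattice, and that it is minimal (if `k`), in the form that each element
of `S` has a private neighbour: a vertex which it alone dominates.

**Existence of the growth rate.** The key is the agreement lemma `exists_sol_agree`: if every element
of a dominating set `U` in a zone `Q` has a private neighbour, then a minimal dominating subset of `U`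
agrees with `U` on `Q`, because it cannot lose such an element. So a solution may be changed freely
near the boundary of a region, as long as it still dominates, and then be made minimal without any
change far from the boundary. Solutions can thus be restricted to a strip (`Sol.restrict`: add two
full rows at the cut) and solutions on adjacent strips be glued (`Sol.glue`: take the union), up to
modifications of `O(1)` rows, i.e. up to a factor `2 ^ (20 m)` in the count when there are `m` columns
(`numSol_add_le`, `numSol_mul_le`). The logarithm of the number of solutions is therefore additive in
the number of rows up to `20 m`, and by symmetry in the number of columns. Its quotient by `n m`
converges, with an explicit error `20 (1 / n + 1 / m)` (`abs_density_sub_limit_le`), to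
`limitDensity`, whose power of two is the growth rate. To write the error term as an exponent one
needs the growth rate to be greater than `1`. This again follows from the agreement lemma: in a grid
cut in `5 × 5` blocks, the centre of each block can be forced to be dominated by exactly one prescribed
vertex, that above or that below it (`two_pow_le_numSol`).

**Computability.** The explicit error reduces the approximation of the growth rate within `1 / n` to
the count of the solutions on the square grid of side `N = 100 n` (`abs_sub_approxNum_div_le`). Trying
all `2 ^ (N ^ 2)` sets takes time polynomial in `2 ^ (N ^ 2)`, which is `2 ^ O(n ^ 2)`. To have an actual
Turing machine, a language `Prog` of loop programs over stacks of bits is compiled to Mathlib's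
multi-stack machines, with the same number of steps (`Prog.machine_outputs`). Numbers are stored in
unary, so polynomial time means polynomial in the values of the numbers; the functions computed in
this sense (`Feas`) are closed under composition and under primitive recursion with polynomially
bounded values (`Feas.prec`), which gives arithmetic, bounded quantifiers and counting. The input and
the output are converted from and to binary by separate programs (`Prog.readBinary`,
`exists_writeBinary`).
-/

namespace GridDomination

/-! ### A structured programming language on stacks of bits -/

/-- Programs acting on stacks of bits (`registers`), indexed by `ℕ`, and on a write-only output
stack. `loop r p q` pops register `r` until it is empty, running `p` after each `true` popped and
`q` after each `false`. -/
inductive Prog : Type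
  | skip : Prog
  | push (r : ℕ) (b : Bool) : Prog
  | emit (c : Option Bool) : Prog
  | seq (p q : Prog) : Prog
  | loop (r : ℕ) (p q : Prog) : Prog

/-- The memory on which a `Prog` acts. -/
@[ext] structure Store where
  /-- the contents of the registers -/
  reg : ℕ → List Bool
  /-- the content of the output stack -/
  out : List (Option Bool)

/-- Replace the content of register `r`. -/
def Store.set (s : Store) (r : ℕ) (l : List Bool) : Store :=
  ⟨Function.update s.reg r l, s.out⟩

/-- `Exec p s t s'`: started in the store `s`, the program `p` stops after `t` steps, in the
store `s'`. -/
inductive Exec : Prog → Store → ℕ → Store → Prop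
  | skip (s) : Exec .skip s 1 s
  | push (r b s) : Exec (.push r b) s 1 (s.set r (b :: s.reg r))
  | emit (c s) : Exec (.emit c) s 1 ⟨s.reg, c :: s.out⟩
  | seq {p q s t s' t' s''} : Exec p s t s' → Exec q s' t' s'' → Exec (.seq p q) s (t + t') s''
  | loop_nil {r p q s} : s.reg r = [] → Exec (.loop r p q) s 1 s
  | loop_cons {r p q s b l t s' t' s''} : s.reg r = b :: l →
      Exec (bif b then p else q) (s.set r l) t s' → Exec (.loop r p q) s' t' s'' →
      Exec (.loop r p q) s (1 + t + t') s''

namespace Prog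

/-- The registers of the program are at most `R`. -/
def RegsLE (R : ℕ) : Prog → Prop
  | skip => True
  | push r _ => r ≤ R
  | emit _ => True
  | seq p q => p.RegsLE R ∧ q.RegsLE R
  | loop r p q => r ≤ R ∧ p.RegsLE R ∧ q.RegsLE R

theorem RegsLE.mono {R R' : ℕ} (h : R ≤ R') : ∀ {p : Prog}, p.RegsLE R → p.RegsLE R'
  | skip, _ => trivial
  | push _ _, hp => le_trans (b := R) hp h
  | emit _, _ => trivial
  | seq _ _, hp => ⟨hp.1.mono h, hp.2.mono h⟩
  | loop _ _ _, hp => ⟨hp.1.trans h, hp.2.1.mono h, hp.2.2.mono h⟩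

theorem exists_regsLE : ∀ p : Prog, ∃ R, p.RegsLE R
  | skip => ⟨0, trivial⟩
  | push r _ => ⟨r, le_refl r⟩
  | emit _ => ⟨0, trivial⟩
  | seq p q => by
    obtain ⟨a, ha⟩ := p.exists_regsLE
    obtain ⟨b, hb⟩ := q.exists_regsLE
    exact ⟨max a b, ha.mono (le_max_left _ _), hb.mono (le_max_right _ _)⟩
  | loop r p q => by
    obtain ⟨a, ha⟩ := p.exists_regsLE
    obtain ⟨b, hb⟩ := q.exists_regsLE
    exact ⟨max r (max a b), le_max_left _ _, ha.mono (by simp), hb.mono (by simp)⟩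

/-- The control locations of a program. -/
def Loc : Prog → Type
  | seq p q => Loc p ⊕ Loc q
  | loop _ p q => Unit ⊕ (Loc p ⊕ Loc q)
  | _ => Unit

noncomputable instance instFintypeLoc : (p : Prog) → Fintype p.Loc
  | skip => inferInstanceAs (Fintype Unit)
  | push _ _ => inferInstanceAs (Fintype Unit)
  | emit _ => inferInstanceAs (Fintype Unit)
  | seq p q => by
    letI := instFintypeLoc p
    letI := instFintypeLoc q
    exact inferInstanceAs (Fintype (p.Loc ⊕ q.Loc))
  | loop _ p q => by
    letI := instFintypeLoc p
    letI := instFintypeLoc q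
    exact inferInstanceAs (Fintype (Unit ⊕ (p.Loc ⊕ q.Loc)))

/-- The control location at which the execution of a program starts. -/
def entry : (p : Prog) → p.Loc
  | skip => ()
  | push _ _ => ()
  | emit _ => ()
  | seq p _ => Sum.inl p.entry
  | loop _ _ _ => Sum.inl ()

/-- The stack alphabets of the compiled machine: `none` indexes the output stack, `some r` the
register `r`. -/
@[reducible] def Alphabet (R : ℕ) : Option (Fin (R + 1)) → Type
  | none => Option Bool
  | some _ => Bool

/-- The statement which the compiled machine executes at each control location. The locations are
embedded by `e` in the labels of the machine, and `x` is what is executed after the program. The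
internal state of the machine holds the last symbol popped by a loop and is `none` between two
statements. -/
def code (R : ℕ) {Λ : Type} : (p : Prog) → (p.Loc → Λ) →
    Turing.TM2.Stmt (Alphabet R) Λ (Option Bool) → p.Loc →
    Turing.TM2.Stmt (Alphabet R) Λ (Option Bool)
  | skip, _, x, _ => x
  | push r b, _, x, _ => .push (some (Fin.ofNat (R + 1) r)) (fun _ => b) x
  | emit c, _, x, _ => .push none (fun _ => c) x
  | seq p q, e, x, l =>
    match l with
    | Sum.inl l => code R p (fun l => e (Sum.inl l)) (.goto fun _ => e (Sum.inr q.entry)) l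
    | Sum.inr l => code R q (fun l => e (Sum.inr l)) x l
  | loop r p q, e, x, l =>
    match l with
    | Sum.inl _ =>
      .pop (some (Fin.ofNat (R + 1) r)) (fun _ (o : Option Bool) => o)
        (.branch (fun v => decide (v = some true))
          (.load (fun _ => none) (.goto fun _ => e (Sum.inr (Sum.inl p.entry))))
          (.branch (fun v => decide (v = some false))
            (.load (fun _ => none) (.goto fun _ => e (Sum.inr (Sum.inr q.entry)))) x))
    | Sum.inr (Sum.inl l) =>
      code R p (fun l => e (Sum.inr (Sum.inl l))) (.goto fun _ => e (Sum.inl ())) l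
    | Sum.inr (Sum.inr l) =>
      code R q (fun l => e (Sum.inr (Sum.inr l))) (.goto fun _ => e (Sum.inl ())) l

/-- The stacks of the compiled machine which represent a store: the registers above `R`, which the
program does not use, are left out. -/
def regStk (R : ℕ) (s : Store) : (k : Option (Fin (R + 1))) → List (Alphabet R k)
  | none => s.out
  | some i => s.reg i

theorem val_ofNat_of_le {R r : ℕ} (hr : r ≤ R) : ((Fin.ofNat (R + 1) r : Fin (R + 1)) : ℕ) = r :=
  Nat.mod_eq_of_lt (Nat.lt_succ_of_le hr)

theorem regStk_set {R r : ℕ} (hr : r ≤ R) (s : Store) (l : List Bool) :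
    Function.update (regStk R s) (some (Fin.ofNat (R + 1) r)) l = regStk R (s.set r l) := by
  funext k
  rcases k with _ | i
  · exact Function.update_of_ne (Option.some_ne_none _).symm _ _
  · by_cases h : i = Fin.ofNat (R + 1) r
    · subst h
      refine (Function.update_self _ _ _).trans ?_
      change l = Function.update s.reg r l ((Fin.ofNat (R + 1) r : Fin (R + 1)) : ℕ)
      rw [val_ofNat_of_le hr, Function.update_self]
    · have h' : (i : ℕ) ≠ r := fun e => h (Fin.ext (by rw [e, val_ofNat_of_le hr]))
      refine (Function.update_of_ne (fun e => h (Option.some_injective _ e)) _ _).trans ?_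
      exact (Function.update_of_ne h' l s.reg).symm

theorem regStk_reg {R r : ℕ} (hr : r ≤ R) (s : Store) :
    regStk R s (some (Fin.ofNat (R + 1) r)) = s.reg r :=
  congrArg s.reg (val_ofNat_of_le hr)

theorem regStk_emit {R : ℕ} (s : Store) (c : Option Bool) :
    Function.update (regStk R s) none (c :: s.out) = regStk R ⟨s.reg, c :: s.out⟩ := by
  funext k
  rcases k with _ | i
  · exact Function.update_self _ _ _
  · exact Function.update_of_ne (Option.some_ne_none _) _ _

open Turing.TM2 in
/-- The head of a loop is executed in one step of the machine. Here `a` and `b` are the entries of the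
two bodies, and `x` is what follows the loop. -/
theorem stepAux_loop {R r : ℕ} (hr : r ≤ R) {Λ : Type} (a b : Λ)
    (x : Stmt (Alphabet R) Λ (Option Bool)) (s : Store) :
    stepAux (.pop (some (Fin.ofNat (R + 1) r)) (fun _ (o : Option Bool) => o)
        (.branch (fun v => decide (v = some true)) (.load (fun _ => none) (.goto fun _ => a))
          (.branch (fun v => decide (v = some false)) (.load (fun _ => none) (.goto fun _ => b))
            x))) none (regStk R s) =
      match s.reg r with
      | [] => stepAux x none (regStk R s)
      | c :: l => ⟨some (bif c then a else b), none, regStk R (s.set r l)⟩ := by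
  have h1 : regStk R s (some (Fin.ofNat (R + 1) r)) = s.reg r := regStk_reg hr s
  have h2 := regStk_set hr s (s.reg r).tail
  rw [stepAux, h1]
  rw [h2]
  cases h : s.reg r with
  | nil =>
    have h3 : s.set r [] = s := by
      ext1
      · simp [Store.set, ← h]
      · rfl
    rw [List.tail_nil, h3]
    rfl
  | cons c l => cases c <;> rfl

open Turing.TM2 in
/-- The compiled code runs in lockstep with the semantics of the language. The last statement of the
program shares its machine step with `x`, which is why the result is `stepAux x` and not a further
configuration reached by a jump. -/
theorem code_correct {R : ℕ} {Λ : Type} (m : Λ → Stmt (Alphabet R) Λ (Option Bool)) {p : Prog}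
    {s s' : Store} {t : ℕ} (h : Exec p s t s') : p.RegsLE R → ∀ (e : p.Loc → Λ)
    (x : Stmt (Alphabet R) Λ (Option Bool)), (∀ l, m (e l) = code R p e x l) →
    (flip bind (step m))^[t] (some ⟨some (e p.entry), none, regStk R s⟩) =
      some (stepAux x none (regStk R s')) := by
  have one : ∀ (a : Λ) (S), flip bind (step m) (some ⟨some a, none, S⟩) =
    some (stepAux (m a) none S) := fun _ _ => rfl
  induction h with
  | skip s =>
    intro _ e x hm
    rw [Function.iterate_one, one, hm]
    rfl
  | push r b s =>
    intro hr e x hm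
    have h1 := regStk_set hr s (b :: s.reg r)
    rw [Function.iterate_one, one, hm, ← h1, ← regStk_reg hr s]
    rfl
  | emit c s =>
    intro _ e x hm
    rw [Function.iterate_one, one, hm, ← regStk_emit]
    rfl
  | @seq p q s t s' t' s'' _ _ ih1 ih2 =>
    intro hr e x hm
    have h1 := ih1 hr.1 (fun l => e (Sum.inl l)) (.goto fun _ => e (Sum.inr q.entry))
      (fun l => hm (Sum.inl l))
    have h2 := ih2 hr.2 (fun l => e (Sum.inr l)) x (fun l => hm (Sum.inr l))
    rw [Nat.add_comm t t', Function.iterate_add_apply]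
    refine Eq.trans (congrArg _ h1) ?_
    exact h2
  | @loop_nil r p q s h0 =>
    intro hr e x hm
    have h1 := stepAux_loop hr.1 (e (Sum.inr (Sum.inl p.entry))) (e (Sum.inr (Sum.inr q.entry)))
      x s
    rw [h0] at h1
    rw [Function.iterate_one, one, hm]
    exact congrArg some h1
  | @loop_cons r p q s b l t s' t' s'' h0 _ _ ih1 ih2 =>
    intro hr e x hm
    have h3 := ih2 hr e x hm
    have h1 := stepAux_loop hr.1 (e (Sum.inr (Sum.inl p.entry))) (e (Sum.inr (Sum.inr q.entry)))
      x s
    rw [h0] at h1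
    have h5 := (one (e (Sum.inl ())) (regStk R s)).trans (congrArg some ((congrArg
      (fun y => stepAux y none (regStk R s)) (hm (Sum.inl ()))).trans h1))
    have h4 : (flip bind (step m))^[t] (some ⟨some (bif b then e (Sum.inr (Sum.inl p.entry)) else
        e (Sum.inr (Sum.inr q.entry))), none, regStk R (s.set r l)⟩) =
        some ⟨some (e (Sum.inl ())), none, regStk R s'⟩ := by
      cases b with
      | true =>
        exact ih1 hr.2.1 (fun l => e (Sum.inr (Sum.inl l))) (.goto fun _ => e (Sum.inl ()))
          (fun l => hm (Sum.inr (Sum.inl l)))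
      | false =>
        exact ih1 hr.2.2 (fun l => e (Sum.inr (Sum.inr l))) (.goto fun _ => e (Sum.inl ()))
          (fun l => hm (Sum.inr (Sum.inr l)))
    have h6 : (flip bind (step m))^[t' + (t + 1)]
        (some ⟨some (e (entry (.loop r p q))), none, regStk R s⟩) =
        some (stepAux x none (regStk R s'')) := by
      rw [Function.iterate_add_apply, Function.iterate_succ_apply]
      refine Eq.trans (congrArg (fun y => (flip bind (step m))^[t'] ((flip bind (step m))^[t] y))
        h5) ?_
      refine Eq.trans (congrArg _ h4) ?_
      exact h3
    rw [← h6]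
    congr 1
    omega

/-- The Turing machine which executes `p` with the input on register `0`. -/
noncomputable def machine (R : ℕ) (p : Prog) : Turing.FinTM2 where
  K := Option (Fin (R + 1))
  k₀ := some 0
  k₁ := none
  Γ := Alphabet R
  Λ := p.Loc
  main := p.entry
  σ := Option Bool
  initialState := none
  Γk₀Fin := inferInstanceAs (Fintype Bool)
  m := code R p id .halt

/-- The machine which executes `p`, as a machine with binary input. -/
noncomputable def machineAux (R : ℕ) (p : Prog) :
    Turing.TM2ComputableAux Bool (Option Bool) where
  tm := machine R p
  inputAlphabet := Equiv.refl Bool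
  outputAlphabet := Equiv.refl (Option Bool)

/-- A program which, from a store with the word `l` in register `0`, produces the word `o` and
erases its registers gives a Turing machine with input `l` and output `o`, with the same number
of steps. -/
theorem machine_outputs {R : ℕ} {p : Prog} (hR : p.RegsLE R) {l : List Bool}
    {o : List (Option Bool)} {t T : ℕ} (ht : t ≤ T)
    (h : Exec p ⟨Function.update (fun _ => []) 0 l, []⟩ t ⟨fun _ => [], o⟩) :
    Nonempty (Turing.TM2OutputsInTime (machineAux R p).tm
      (l.map (machineAux R p).inputAlphabet.symm)
      (some (o.map (machineAux R p).outputAlphabet.symm)) T) := by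
  refine ⟨⟨⟨t, ?_⟩, ht⟩⟩
  have h1 := code_correct (code R p id .halt) h hR id .halt (fun _ => rfl)
  have e1 : l.map (machineAux R p).inputAlphabet.symm = l := List.map_id l
  have e2 : o.map (machineAux R p).outputAlphabet.symm = o := List.map_id o
  rw [e1, e2]
  have i1 : Turing.initList (machineAux R p).tm l =
      (⟨some p.entry, none, regStk R ⟨Function.update (fun _ => []) 0 l, []⟩⟩ :
        Turing.TM2.Cfg (Alphabet R) p.Loc (Option Bool)) := by
    refine congrArg (fun S => (⟨some p.entry, none, S⟩ :
        Turing.TM2.Cfg (Alphabet R) p.Loc (Option Bool))) (funext fun k => ?_)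
    rcases k with _ | i
    · rfl
    · by_cases hi : i = 0
      · subst hi
        rfl
      · have h0 : (i : ℕ) ≠ 0 := fun e => hi (Fin.ext e)
        refine (dif_neg (fun e => hi (Option.some_injective _ e))).trans ?_
        exact (Function.update_of_ne (β := fun _ => List Bool) h0 l (fun _ => [])).symm
  have i2 : Turing.haltList (machineAux R p).tm o =
      (⟨none, none, regStk R ⟨fun _ => [], o⟩⟩ :
        Turing.TM2.Cfg (Alphabet R) p.Loc (Option Bool)) := by
    refine congrArg (fun S => (⟨none, none, S⟩ :
        Turing.TM2.Cfg (Alphabet R) p.Loc (Option Bool))) (funext fun k => ?_)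
    rcases k with _ | i <;> rfl
  exact (congrArg (fun c => (flip bind (machineAux R p).tm.step)^[t] (some c)) i1).trans
    (h1.trans (congrArg some i2.symm))

end Prog

/-! ### Execution of programs on unary registers -/

namespace Store

@[simp] theorem reg_set_self (s : Store) (r : ℕ) (l : List Bool) : (s.set r l).reg r = l :=
  Function.update_self _ _ _

theorem reg_set_of_ne (s : Store) {r r' : ℕ} (l : List Bool) (h : r' ≠ r) :
    (s.set r l).reg r' = s.reg r' :=
  Function.update_of_ne h _ _

theorem reg_set (s : Store) (r r' : ℕ) (l : List Bool) :
    (s.set r l).reg r' = if r' = r then l else s.reg r' :=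
  Function.update_apply _ _ _ _

@[simp] theorem set_set (s : Store) (r : ℕ) (l l' : List Bool) :
    (s.set r l).set r l' = s.set r l' := by
  ext1
  · exact Function.update_idem _ _ _
  · rfl

theorem set_comm (s : Store) {r r' : ℕ} (h : r ≠ r') (l l' : List Bool) :
    (s.set r l).set r' l' = (s.set r' l').set r l := by
  ext1
  · exact Function.update_comm h _ _ _
  · rfl

theorem set_eq_self (s : Store) {r : ℕ} {l : List Bool} (h : s.reg r = l) : s.set r l = s := by
  ext1
  · subst h
    exact Function.update_eq_self _ _
  · rfl

end Store

/-- The unary representation of a number in a register. -/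
abbrev un (n : ℕ) : List Bool := List.replicate n true

/-- `Runs p s T s'`: started in the store `s`, the program `p` stops after at most `T` steps, in
the store `s'`. -/
def Runs (p : Prog) (s : Store) (T : ℕ) (s' : Store) : Prop := ∃ t ≤ T, Exec p s t s'

namespace Runs

theorem mono {p : Prog} {s s' : Store} {T T' : ℕ} (h : Runs p s T s') (hT : T ≤ T') :
    Runs p s T' s' :=
  let ⟨t, ht, e⟩ := h
  ⟨t, ht.trans hT, e⟩

theorem congr {p : Prog} {s s' s'' : Store} {T T' : ℕ} (h : Runs p s T s') (hT : T ≤ T')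
    (hs : s' = s'') : Runs p s T' s'' :=
  hs ▸ h.mono hT

theorem seq {p q : Prog} {s s' s'' : Store} {T T' : ℕ} (h : Runs p s T s')
    (h' : Runs q s' T' s'') : Runs (.seq p q) s (T + T') s'' :=
  let ⟨_, ht, e⟩ := h
  let ⟨_, ht', e'⟩ := h'
  ⟨_, Nat.add_le_add ht ht', e.seq e'⟩

theorem push (r : ℕ) (b : Bool) (s : Store) : Runs (.push r b) s 1 (s.set r (b :: s.reg r)) :=
  ⟨1, le_rfl, .push r b s⟩

/-- The rule for a loop which is controlled by a unary register: `S i` is the store, apart from the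
control register, after `i` rounds. -/
theorem for_loop {r : ℕ} {p q : Prog} (n : ℕ) (S : ℕ → Store) (T : ℕ → ℕ)
    (h : ∀ i < n, Runs p ((S i).set r (un (n - i - 1))) (T i)
      ((S (i + 1)).set r (un (n - i - 1)))) :
    Runs (.loop r p q) ((S 0).set r (un n)) (1 + ∑ i ∈ Finset.range n, (T i + 1))
      ((S n).set r []) := by
  induction n generalizing S T with
  | zero => exact ⟨1, by simp, .loop_nil (by simp)⟩
  | succ n ih =>
    obtain ⟨t, ht, e⟩ := h 0 (Nat.succ_pos n)
    obtain ⟨t', ht', e'⟩ := ih (fun i => S (i + 1)) (fun i => T (i + 1)) (fun i hi => by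
      have := h (i + 1) (Nat.succ_lt_succ hi)
      rwa [show n + 1 - (i + 1) - 1 = n - i - 1 by omega] at this)
    refine ⟨1 + t + t', ?_, Exec.loop_cons (b := true) (l := un n) ?_ ?_ e'⟩
    · rw [Finset.sum_range_succ']
      omega
    · simp [List.replicate_succ]
    · simpa using e

/-- The rule for a loop which consumes an arbitrary word. -/
theorem word_loop {r : ℕ} {p q : Prog} (l : List Bool) (S : List Bool → Store) (C : ℕ)
    (h : ∀ b l', b :: l' <:+ l → Runs (bif b then p else q) ((S (b :: l')).set r l') C
      ((S l').set r l')) :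
    Runs (.loop r p q) ((S l).set r l) (1 + l.length * (C + 1)) ((S []).set r []) := by
  induction l with
  | nil => exact ⟨1, by simp, .loop_nil (by simp)⟩
  | cons b l ih =>
    obtain ⟨t, ht, e⟩ := h b l (List.suffix_refl _)
    obtain ⟨t', ht', e'⟩ := ih (fun c l' hl => h c l' (hl.trans (List.suffix_cons b l)))
    refine ⟨1 + t + t', ?_, Exec.loop_cons (b := b) (l := l) (by simp) (by simpa using e) e'⟩
    rw [List.length_cons, Nat.succ_mul]
    omega

end Runs

namespace Prog

/-- Empty a register. -/
def clear (r : ℕ) : Prog := loop r skip skip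

theorem clear_runs (r : ℕ) (s : Store) {n : ℕ} (h : s.reg r = un n) :
    Runs (clear r) s (2 * n + 1) (s.set r []) := by
  have := Runs.for_loop (r := r) (p := skip) (q := skip) n (fun _ => s) (fun _ => 1)
    (fun i _ => ⟨1, le_rfl, .skip _⟩)
  rw [s.set_eq_self h] at this
  refine this.mono (by simp; omega)

/-- Add the content of the unary register `r` to the unary register `d`, and empty `r`. -/
def move (r d : ℕ) : Prog := loop r (push d true) skip

theorem move_runs {r d : ℕ} (hrd : r ≠ d) (s : Store) {n m : ℕ} (h : s.reg r = un n)
    (hd : s.reg d = un m) :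
    Runs (move r d) s (2 * n + 1) ((s.set r []).set d (un (n + m))) := by
  have := Runs.for_loop (r := r) (p := push d true) (q := skip) n (fun i => s.set d (un (i + m)))
    (fun _ => 1) (fun i _ => by
      refine (Runs.push _ _ _).congr le_rfl ?_
      rw [Store.reg_set_of_ne _ _ hrd.symm, Store.reg_set_self, Store.set_comm _ hrd,
        Store.set_set, ← List.replicate_succ, Nat.add_right_comm])
  rw [zero_add, s.set_eq_self hd, s.set_eq_self h] at this
  refine this.congr (by simp; omega) ?_
  rw [Store.set_comm _ hrd]

/-- Copy the unary register `r` to the empty register `d`, by means of the empty register `t`. -/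
def copy (r d t : ℕ) : Prog := seq (loop r (seq (push d true) (push t true)) skip) (move t r)

theorem copy_runs {r d t : ℕ} (hrd : r ≠ d) (hrt : r ≠ t) (hdt : d ≠ t) (s : Store) {n : ℕ}
    (h : s.reg r = un n) (hd : s.reg d = []) (ht : s.reg t = []) :
    Runs (copy r d t) s (5 * n + 2) (s.set d (un n)) := by
  have h1 := Runs.for_loop (r := r) (p := seq (push d true) (push t true)) (q := skip) n
    (fun i => (s.set d (un i)).set t (un i)) (fun _ => 2) (fun i _ => by
      refine ((Runs.push _ _ _).seq (Runs.push _ _ _)).congr le_rfl ?_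
      simp [Store.reg_set, hrd.symm, hrt.symm, hdt, hdt.symm, List.replicate_succ]
      ext1
      · funext x
        simp only [Store.reg_set]
        split_ifs <;> simp_all
      · rfl)
  have e0 : ((s.set d (un 0)).set t (un 0)).set r (un n) = s := by
    rw [s.set_eq_self (r := d) (l := un 0) hd, s.set_eq_self (r := t) (l := un 0) ht,
      s.set_eq_self h]
  beta_reduce at h1
  rw [e0] at h1
  refine (h1.seq (move_runs (n := n) (m := 0) hrt.symm _ ?_ ?_)).congr (by simp; omega) ?_
  · simp [Store.reg_set, hrt.symm]
  · simp
  · ext1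
    · funext x
      simp only [Store.reg_set]
      split_ifs <;> simp_all
    · rfl

end Prog

/-! ### Functions computed in polynomial time on unary numbers -/

/-- A type whose elements are finite tuples of natural numbers. -/
class Ctx (α : Type) where
  /-- the length of the tuples -/
  arity : ℕ
  /-- the entries of a tuple (those with index less than `arity`) -/
  get : α → ℕ → ℕ

instance : Ctx ℕ := ⟨1, fun a _ => a⟩

instance {α : Type} [Ctx α] : Ctx (ℕ × α) :=
  ⟨Ctx.arity α + 1, fun p i => Nat.casesOn i p.1 (Ctx.get p.2)⟩

/-- The sum of the entries of a tuple. -/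
def Ctx.size {α : Type} [Ctx α] (a : α) : ℕ := ∑ i ∈ Finset.range (arity α), get a i

@[simp] theorem Ctx.size_nat (n : ℕ) : Ctx.size n = n := by
  simp [Ctx.size, Ctx.arity, Ctx.get]

@[simp] theorem Ctx.size_prod {α : Type} [Ctx α] (p : ℕ × α) :
    Ctx.size p = p.1 + Ctx.size p.2 := by
  simp only [Ctx.size, Ctx.arity, Ctx.get]
  rw [Finset.sum_range_succ', add_comm]
  rfl

section Feasible

variable {α β : Type} [Ctx α] [Ctx β]

/-- `f` is bounded by a polynomial in the sum of the arguments. The base is at least `2`, so that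
constants and factors can be absorbed in the exponent. -/
def PolyBd (f : α → ℕ) : Prop := ∃ c : ℕ, ∀ a, f a ≤ (Ctx.size a + 2) ^ c

namespace PolyBd

theorem mono {f g : α → ℕ} (hg : PolyBd g) (h : ∀ a, f a ≤ g a) : PolyBd f :=
  let ⟨c, hc⟩ := hg
  ⟨c, fun a => (h a).trans (hc a)⟩

theorem const (n : ℕ) : PolyBd (fun _ : α => n) :=
  ⟨n, fun a => Nat.lt_two_pow_self.le.trans (Nat.pow_le_pow_left (by omega) n)⟩

theorem size : PolyBd (fun a : α => Ctx.size a) :=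
  ⟨1, fun a => by simp⟩

theorem mul {f g : α → ℕ} (hf : PolyBd f) (hg : PolyBd g) : PolyBd (fun a => f a * g a) :=
  let ⟨c, hc⟩ := hf
  let ⟨d, hd⟩ := hg
  ⟨c + d, fun a => by
    rw [pow_add]
    exact Nat.mul_le_mul (hc a) (hd a)⟩

theorem add {f g : α → ℕ} (hf : PolyBd f) (hg : PolyBd g) : PolyBd (fun a => f a + g a) :=
  let ⟨c, hc⟩ := hf
  let ⟨d, hd⟩ := hg
  ⟨c + d + 1, fun a => by
    have h1 := hc a
    have h2 := hd a
    have h3 : (Ctx.size a + 2) ^ c ≤ (Ctx.size a + 2) ^ (c + d) :=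
      Nat.pow_le_pow_right (by omega) (by omega)
    have h4 : (Ctx.size a + 2) ^ d ≤ (Ctx.size a + 2) ^ (c + d) :=
      Nat.pow_le_pow_right (by omega) (by omega)
    have h5 : (Ctx.size a + 2) ^ (c + d) * 2 ≤ (Ctx.size a + 2) ^ (c + d) * (Ctx.size a + 2) :=
      Nat.mul_le_mul_left _ (by omega)
    rw [pow_succ]
    dsimp only
    omega⟩

theorem pow {f : α → ℕ} (hf : PolyBd f) (k : ℕ) : PolyBd (fun a => f a ^ k) :=
  let ⟨c, hc⟩ := hf
  ⟨c * k, fun a => by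
    rw [pow_mul]
    exact Nat.pow_le_pow_left (hc a) k⟩

theorem comp {f : β → ℕ} (hf : PolyBd f) {G : α → β} (hG : PolyBd (fun a => Ctx.size (G a))) :
    PolyBd (fun a => f (G a)) :=
  let ⟨c, hc⟩ := hf
  ((hG.add (const 2)).pow c).mono fun a => hc (G a)

/-- A polynomially bounded function has a monotone polynomial bound. -/
theorem exists_mono {f : α → ℕ} (hf : PolyBd f) :
    ∃ c, ∀ a n, Ctx.size a ≤ n → f a ≤ (n + 2) ^ c :=
  let ⟨c, hc⟩ := hf
  ⟨c, fun a _ hn => (hc a).trans (Nat.pow_le_pow_left (by omega) c)⟩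

end PolyBd

/-- The tuple `a` is stored in unary in the registers `args 0, args 1, …`, which are less than `b`,
and all registers from `b` on are empty. -/
def Ready (s : Store) (args : ℕ → ℕ) (b : ℕ) (a : α) : Prop :=
  (∀ i < Ctx.arity α, args i < b ∧ s.reg (args i) = un (Ctx.get a i)) ∧ ∀ r, b ≤ r → s.reg r = []

/-- `f` is computed on unary numbers within `τ` steps, wherever the arguments are stored: the
result is stored in the first free register `b`, and all other registers are restored. The program
may depend on the places of the arguments. The bound `τ` is also required to bound the value of
`f`. -/
def CompIn (τ : α → ℕ) (f : α → ℕ) : Prop :=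
  (∀ a, f a ≤ τ a) ∧ ∃ P : (ℕ → ℕ) → ℕ → Prog, ∀ args b s a, Ready s args b a →
    Runs (P args b) s (τ a) (s.set b (un (f a)))

/-- `f` is computed in polynomial time on unary numbers. -/
def Feas (f : α → ℕ) : Prop := ∃ τ, PolyBd τ ∧ CompIn τ f

/-- Prepend a register to a list of registers. -/
def consArg (r : ℕ) (args : ℕ → ℕ) : ℕ → ℕ := fun i => Nat.casesOn i r args

theorem Ready.cons {s : Store} {args : ℕ → ℕ} {b : ℕ} {a : α} (h : Ready s args b a) (n : ℕ) :
    Ready (s.set b (un n)) (consArg b args) (b + 1) (n, a) := by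
  refine ⟨fun i hi => ?_, fun r hr => ?_⟩
  · rcases i with _ | i
    · exact ⟨Nat.lt_succ_self b, s.reg_set_self b _⟩
    · have h1 := h.1 i (Nat.lt_of_succ_lt_succ hi)
      refine ⟨h1.1.trans (Nat.lt_succ_self b), ?_⟩
      exact (s.reg_set_of_ne _ h1.1.ne).trans h1.2
  · rw [s.reg_set_of_ne _ (by omega)]
    exact h.2 r (by omega)

theorem Ready.tail {s : Store} {args : ℕ → ℕ} {b n : ℕ} {a : α} (h : Ready s args b (n, a)) :
    Ready s (fun i => args (i + 1)) b a :=
  ⟨fun i hi => h.1 (i + 1) (Nat.succ_lt_succ hi), h.2⟩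

/-- The value of `g` is pushed in front of the tuple of arguments, `f` is computed, and its value
replaces that of `g`. -/
theorem CompIn.letIn {τ : α → ℕ} {τ' : ℕ × α → ℕ} {g : α → ℕ} {f : ℕ × α → ℕ}
    (hg : CompIn τ g) (hf : CompIn τ' f) :
    CompIn (fun a => 3 * τ a + 3 * τ' (g a, a) + 2) (fun a => f (g a, a)) := by
  obtain ⟨hg, P, hP⟩ := hg
  obtain ⟨hf, Q, hQ⟩ := hf
  refine ⟨fun a => by have := hf (g a, a); dsimp only; omega, fun args b => .seq (P args b)
    (.seq (Q (consArg b args) (b + 1)) (.seq (.clear b) (.move (b + 1) b))), ?_⟩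
  intro args b s a h
  have h1 := hP args b s a h
  have h2 := hQ _ _ _ _ (h.cons (g a))
  have h3 := Prog.clear_runs b ((s.set b (un (g a))).set (b + 1) (un (f (g a, a)))) (n := g a)
    (by simp [Store.reg_set])
  have h4 := Prog.move_runs (r := b + 1) (d := b) (n := f (g a, a)) (m := 0) (by omega)
    (((s.set b (un (g a))).set (b + 1) (un (f (g a, a)))).set b []) (by simp [Store.reg_set])
    (by simp)
  refine (h1.seq (h2.seq (h3.seq h4))).congr ?_ ?_
  · have h5 := hg a
    have h6 := hf (g a, a)
    dsimp only
    omega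
  · ext1
    · have := h.2 (b + 1) (by omega)
      funext x
      simp only [Store.reg_set]
      split_ifs <;> simp_all
    · rfl

/-- Primitive recursion on the first argument. -/
def precFn {α : Type} (g : α → ℕ) (h : ℕ × ℕ × α → ℕ) (p : ℕ × α) : ℕ :=
  Nat.rec (g p.2) (fun i r => h (i, r, p.2)) p.1

theorem precFn_zero {α : Type} (g : α → ℕ) (h : ℕ × ℕ × α → ℕ) (a : α) :
    precFn g h (0, a) = g a := rfl

theorem precFn_succ {α : Type} (g : α → ℕ) (h : ℕ × ℕ × α → ℕ) (n : ℕ) (a : α) :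
    precFn g h (n + 1, a) = h (n, precFn g h (n, a), a) := rfl

/-- Primitive recursion is computed by a loop. Register `b` holds the current value, `b + 1` the
number of rounds which remain, `b + 2` the number of rounds done, and `b + 3` the next value. -/
theorem CompIn.prec {τ : α → ℕ} {τ' : ℕ × ℕ × α → ℕ} {g : α → ℕ} {h : ℕ × ℕ × α → ℕ}
    (hg : CompIn τ g) (hh : CompIn τ' h) :
    CompIn (fun p : ℕ × α => 3 * τ p.2 +
      ∑ i ∈ Finset.range p.1, 5 * τ' (i, precFn g h (i, p.2), p.2) + 20 * p.1 + 10)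
      (precFn g h) := by
  obtain ⟨hg, P, hP⟩ := hg
  obtain ⟨hh, Q, hQ⟩ := hh
  have hval : ∀ n a, precFn g h (n, a) ≤ τ a +
      ∑ i ∈ Finset.range n, τ' (i, precFn g h (i, a), a) := by
    intro n a
    rcases n with _ | n
    · simpa [precFn_zero] using hg a
    · rw [precFn_succ, Finset.sum_range_succ]
      have := hh (n, precFn g h (n, a), a)
      omega
  refine ⟨fun p => ?_, fun args b => .seq (P (fun i => args (i + 1)) b)
    (.seq (.copy (args 0) (b + 1) (b + 2)) (.seq (.loop (b + 1)
      (.seq (Q (consArg (b + 2) (consArg b fun i => args (i + 1))) (b + 3))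
        (.seq (.clear b) (.seq (.move (b + 3) b) (.push (b + 2) true)))) .skip)
      (.clear (b + 2)))), ?_⟩
  · have := hval p.1 p.2
    dsimp only
    rw [← Finset.mul_sum]
    change precFn g h (p.1, p.2) ≤ _
    omega
  · rintro args b s ⟨n, a⟩ hs
    set F := fun i => precFn g h (i, a) with hF
    have hn : args 0 < b ∧ s.reg (args 0) = un n := hs.1 0 (Nat.succ_pos _)
    have hz : ∀ k, s.reg (b + k) = [] := fun k => hs.2 _ (by omega)
    have hb : s.reg b = [] := hz 0
    have h1 := hP _ b s a hs.tail
    have h2 := Prog.copy_runs (r := args 0) (d := b + 1) (t := b + 2) (n := n) (by omega)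
      (by omega) (by omega) (s.set b (un (g a))) (by rw [Store.reg_set_of_ne _ _ hn.1.ne, hn.2])
      (by simp [Store.reg_set, hz]) (by simp [Store.reg_set, hz])
    have h3 := Runs.for_loop (r := b + 1) (q := .skip)
      (p := .seq (Q (consArg (b + 2) (consArg b fun i => args (i + 1))) (b + 3))
        (.seq (.clear b) (.seq (.move (b + 3) b) (.push (b + 2) true)))) n
      (fun i => (s.set b (un (F i))).set (b + 2) (un i))
      (fun i => τ' (i, F i, a) + (2 * F i + 1 + (2 * F (i + 1) + 1 + 1))) (fun i hi => by
        set s' := ((s.set b (un (F i))).set (b + 2) (un i)).set (b + 1) (un (n - i - 1))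
        have hr : Ready s' (consArg (b + 2) (consArg b fun i => args (i + 1))) (b + 3)
            (i, F i, a) := by
          refine ⟨fun j hj => ?_, fun r hr => ?_⟩
          · rcases j with _ | _ | j
            · exact ⟨by simp [consArg], by simp [consArg, Ctx.get, s', Store.reg_set]⟩
            · exact ⟨by simp [consArg], by simp [consArg, Ctx.get, s', Store.reg_set]⟩
            · have h4 := hs.tail.1 j (by simpa [Ctx.arity] using hj)
              have h6 : args (j + 1) < b := h4.1
              have h5 : args (j + 1) ≠ b ∧ args (j + 1) ≠ b + 1 ∧ args (j + 1) ≠ b + 2 := by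
                omega
              refine ⟨by simp only [consArg]; omega, ?_⟩
              simp only [consArg, s', Store.reg_set, h5.1, h5.2.1, h5.2.2, if_false]
              exact h4.2
          · simp only [s', Store.reg_set]
            rw [if_neg (by omega), if_neg (by omega), if_neg (by omega)]
            exact hs.2 r (by omega)
        have k1 := hQ _ _ _ _ hr
        have k2 := Prog.clear_runs b (s'.set (b + 3) (un (h (i, F i, a)))) (n := F i)
          (by simp [s', Store.reg_set])
        have k3 := Prog.move_runs (r := b + 3) (d := b) (n := h (i, F i, a)) (m := 0) (by omega)
          ((s'.set (b + 3) (un (h (i, F i, a)))).set b []) (by simp [Store.reg_set]) (by simp)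
        refine (k1.seq (k2.seq (k3.seq (Runs.push _ _ _)))).congr le_rfl ?_
        have k4 := hz 3
        have k5 : F (i + 1) = h (i, F i, a) := rfl
        rw [k5]
        ext1
        · funext x
          simp only [s', Store.reg_set]
          split_ifs <;> first | omega | simp_all [List.replicate_succ]
        · rfl)
    have h4 := Prog.clear_runs (b + 2) (((s.set b (un (F n))).set (b + 2) (un n)).set (b + 1) [])
      (n := n) (by simp [Store.reg_set])
    beta_reduce at h3
    have e1 : ((s.set b (un (F 0))).set (b + 2) (un 0)).set (b + 1) (un n) =
        (s.set b (un (g a))).set (b + 1) (un n) := by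
      rw [(s.set b (un (F 0))).set_eq_self (r := b + 2) (l := un 0) (by simp [Store.reg_set, hz])]
      rfl
    rw [e1] at h3
    refine (h1.seq (h2.seq (h3.seq h4))).congr ?_ ?_
    · have hb1 : ∑ i ∈ Finset.range n,
          (τ' (i, F i, a) + (2 * F i + 1 + (2 * F (i + 1) + 1 + 1)) + 1) ≤
          ∑ i ∈ Finset.range n, (3 * τ' (i, F i, a) + 4) + ∑ i ∈ Finset.range n, 2 * F i := by
        rw [← Finset.sum_add_distrib]
        refine Finset.sum_le_sum fun i _ => ?_
        have : F (i + 1) ≤ τ' (i, F i, a) := hh (i, F i, a)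
        omega
      have hb2 : ∑ i ∈ Finset.range n, F i ≤
          τ a + ∑ i ∈ Finset.range n, τ' (i, F i, a) := by
        rcases n with _ | n
        · simp
        · rw [Finset.sum_range_succ']
          have h6 : F 0 ≤ τ a := hg a
          have h7 : ∑ i ∈ Finset.range n, F (i + 1) ≤
              ∑ i ∈ Finset.range (n + 1), τ' (i, F i, a) := by
            rw [Finset.sum_range_succ]
            exact (Finset.sum_le_sum fun i _ => hh (i, F i, a)).trans (Nat.le_add_right _ _)
          omega
      have hb3 : ∑ i ∈ Finset.range n, (3 * τ' (i, F i, a) + 4) =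
          3 * ∑ i ∈ Finset.range n, τ' (i, F i, a) + 4 * n := by
        rw [Finset.sum_add_distrib, Finset.mul_sum]
        simp [mul_comm]
      have hb4 : ∑ i ∈ Finset.range n, 2 * F i = 2 * ∑ i ∈ Finset.range n, F i :=
        (Finset.mul_sum _ _ _).symm
      have hb5 : ∑ i ∈ Finset.range n, 5 * τ' (i, precFn g h (i, a), a) =
          5 * ∑ i ∈ Finset.range n, τ' (i, F i, a) := (Finset.mul_sum _ _ _).symm
      dsimp only
      omega
    · have hz1 := hz 1
      have hz2 := hz 2
      change _ = s.set b (un (F n))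
      ext1
      · funext x
        simp only [Store.reg_set]
        split_ifs <;> simp_all
      · rfl

end Feasible

/-! ### Closure properties of the functions computed in polynomial time -/

section Feasible

variable {α β : Type} [Ctx α] [Ctx β]

/-- The entries of the tuple `π a` are among the entries of `a`, at places which do not depend on
`a`. -/
def Ren (π : α → β) : Prop :=
  ∃ ρ : ℕ → ℕ, ∀ i < Ctx.arity β, ρ i < Ctx.arity α ∧ ∀ a, Ctx.get (π a) i = Ctx.get a (ρ i)

namespace Ren

theorem fst : Ren (fun p : ℕ × α => p.1) :=
  ⟨fun _ => 0, fun _ _ => ⟨Nat.succ_pos _, fun _ => rfl⟩⟩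

theorem snd : Ren (fun p : ℕ × α => p.2) :=
  ⟨fun i => i + 1, fun _ hi => ⟨Nat.succ_lt_succ hi, fun _ => rfl⟩⟩

theorem comp {γ : Type} [Ctx γ] {π : β → γ} {π' : α → β} (h : Ren π) (h' : Ren π') :
    Ren (fun a => π (π' a)) :=
  let ⟨ρ, hρ⟩ := h
  let ⟨ρ', hρ'⟩ := h'
  ⟨fun i => ρ' (ρ i), fun i hi => ⟨(hρ' _ (hρ i hi).1).1, fun a => by
    rw [(hρ i hi).2, (hρ' _ (hρ i hi).1).2]⟩⟩

theorem pair {π : α → ℕ} {π' : α → β} (h : Ren π) (h' : Ren π') : Ren (fun a => (π a, π' a)) :=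
  let ⟨ρ, hρ⟩ := h
  let ⟨ρ', hρ'⟩ := h'
  ⟨fun i => Nat.casesOn i (ρ 0) ρ', fun i hi => by
    rcases i with _ | i
    · exact ⟨(hρ 0 Nat.one_pos).1, fun a => (hρ 0 Nat.one_pos).2 a⟩
    · exact hρ' i (Nat.lt_of_succ_lt_succ hi)⟩

theorem size_le {π : α → β} (h : Ren π) : PolyBd (fun a => Ctx.size (π a)) := by
  obtain ⟨ρ, hρ⟩ := h
  refine ((PolyBd.const (Ctx.arity β)).mul PolyBd.size).mono fun a => ?_
  have := Finset.sum_le_card_nsmul (Finset.range (Ctx.arity β)) (fun i => Ctx.get (π a) i)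
    (Ctx.size a) (fun i hi => by
      have hi := hρ i (Finset.mem_range.1 hi)
      rw [hi.2 a]
      exact Finset.single_le_sum (f := fun j => Ctx.get a j) (fun _ _ => Nat.zero_le _)
        (Finset.mem_range.2 hi.1))
  rw [Finset.card_range, smul_eq_mul] at this
  exact this

end Ren

namespace Feas

theorem polyBd {f : α → ℕ} (hf : Feas f) : PolyBd f :=
  let ⟨_, hτ, h⟩ := hf
  hτ.mono h.1

theorem congr {f g : α → ℕ} (hf : Feas f) (h : ∀ a, g a = f a) : Feas g := by
  rwa [funext h]

theorem rename {f : β → ℕ} (hf : Feas f) {π : α → β} (hπ : Ren π) : Feas (fun a => f (π a)) := by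
  obtain ⟨τ, hτ, hb, P, hP⟩ := hf
  have hs := hπ.size_le
  obtain ⟨ρ, hρ⟩ := hπ
  refine ⟨fun a => τ (π a), hτ.comp hs, fun a => hb _, fun args b => P (fun i => args (ρ i)) b, ?_⟩
  intro args b s a h
  refine hP _ b s (π a) ⟨fun i hi => ?_, h.2⟩
  rw [(hρ i hi).2]
  exact h.1 _ (hρ i hi).1

/-- A binding `let x := g a`. -/
theorem letIn {g : α → ℕ} {f : ℕ × α → ℕ} (hf : Feas f) (hg : Feas g) :
    Feas (fun a => f (g a, a)) := by
  have hb := hg.polyBd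
  obtain ⟨τ, hτ, hg⟩ := hg
  obtain ⟨τ', hτ', hf⟩ := hf
  refine ⟨_, ?_, hg.letIn hf⟩
  refine (((PolyBd.const 3).mul hτ).add ((PolyBd.const 3).mul (hτ'.comp ?_))).add
    (PolyBd.const 2)
  simpa using hb.add PolyBd.size

theorem zero : Feas (fun _ : α => 0) :=
  ⟨fun _ => 1, PolyBd.const 1, fun _ => Nat.zero_le _, fun _ _ => .skip, fun args b s a h =>
    ⟨1, le_rfl, by
      rw [s.set_eq_self (l := un 0) (h.2 b le_rfl)]
      exact .skip s⟩⟩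

theorem succ {f : α → ℕ} (hf : Feas f) : Feas (fun a => f a + 1) := by
  obtain ⟨τ, hτ, hb, P, hP⟩ := hf
  refine ⟨fun a => τ a + 1, hτ.add (PolyBd.const 1), fun a => Nat.succ_le_succ (hb a),
    fun args b => .seq (P args b) (.push b true), ?_⟩
  intro args b s a h
  refine ((hP args b s a h).seq (Runs.push _ _ _)).congr le_rfl ?_
  simp [List.replicate_succ]

theorem const (n : ℕ) : Feas (fun _ : α => n) := by
  induction n with
  | zero => exact zero
  | succ n ih => exact ih.succ

theorem id : Feas (fun n : ℕ => n) := by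
  refine ⟨fun n => 5 * n + 2, ?_, fun n => by dsimp only; omega,
    fun args b => .copy (args 0) b (b + 1), ?_⟩
  · refine (((PolyBd.const 5).mul PolyBd.size).add (PolyBd.const 2)).mono fun a => ?_
    simp
  · intro args b s n h
    have h0 := h.1 0 Nat.one_pos
    exact Prog.copy_runs (by omega) (by omega) (by omega) s h0.2 (h.2 b le_rfl) (h.2 _ (by omega))

theorem var {π : α → ℕ} (hπ : Ren π) : Feas π := id.rename hπ

theorem letRen {f : ℕ × β → ℕ} (hf : Feas f) {g : α → ℕ} (hg : Feas g) {π : α → β} (hπ : Ren π) :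
    Feas (fun a => f (g a, π a)) :=
  letIn (f := fun p : ℕ × α => f (p.1, π p.2))
    (hf.rename (Ren.fst.pair (hπ.comp Ren.snd))) hg

theorem comp2 {f : ℕ × ℕ → ℕ} (hf : Feas f) {g₁ g₂ : α → ℕ} (h₁ : Feas g₁) (h₂ : Feas g₂) :
    Feas (fun a => f (g₁ a, g₂ a)) :=
  letIn (f := fun p : ℕ × α => f (g₁ p.2, p.1))
    (letRen hf (h₁.rename Ren.snd) Ren.fst) h₂

/-- Primitive recursion is feasible when the values of the function are polynomially bounded: the
step function is then only evaluated at arguments of polynomial size. -/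
theorem prec {g : α → ℕ} {h : ℕ × ℕ × α → ℕ} (hg : Feas g) (hh : Feas h)
    (hb : PolyBd (precFn g h)) : Feas (precFn g h) := by
  obtain ⟨τ, hτ, hg⟩ := hg
  obtain ⟨τ', hτ', hh⟩ := hh
  refine ⟨_, ?_, hg.prec hh⟩
  obtain ⟨c, hc⟩ := hb.exists_mono
  obtain ⟨d, hd⟩ := hτ'.exists_mono
  have hn : PolyBd (fun p : ℕ × α => p.1) := PolyBd.size.mono fun p => by simp
  have h2 : PolyBd (fun p : ℕ × α => τ p.2) := hτ.comp Ren.snd.size_le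
  have hsz : PolyBd (fun p : ℕ × α => Ctx.size p) := PolyBd.size
  refine ((((PolyBd.const 3).mul h2).add (hn.mul ((PolyBd.const 5).mul
    (((hsz.add ((hsz.add (PolyBd.const 2)).pow c)).add (PolyBd.const 2)).pow d)))).add
    ((PolyBd.const 20).mul hn)).add (PolyBd.const 10) |>.mono fun p => ?_
  refine Nat.add_le_add_right (Nat.add_le_add_right (Nat.add_le_add_left ?_ _) _) _
  refine (Finset.sum_le_card_nsmul _ _ (5 * (Ctx.size p + (Ctx.size p + 2) ^ c + 2) ^ d)
    fun i hi => ?_).trans (by simp)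
  have hi := Finset.mem_range.1 hi
  refine Nat.mul_le_mul_left _ (hd _ _ ?_)
  have h3 := hc (i, p.2) (Ctx.size p) (by simp; omega)
  simp only [Ctx.size_prod] at h3 ⊢
  omega

theorem prec' {n : α → ℕ} {g : α → ℕ} {h : ℕ × ℕ × α → ℕ} (hn : Feas n) (hg : Feas g)
    (hh : Feas h) (hb : PolyBd (precFn g h)) : Feas (fun a => precFn g h (n a, a)) :=
  letIn (prec hg hh hb) hn

theorem fst : Feas (fun p : ℕ × α => p.1) := var Ren.fst

theorem snd_fst : Feas (fun p : ℕ × ℕ × α => p.2.1) := var (Ren.fst.comp Ren.snd)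

theorem snd {f : α → ℕ} (hf : Feas f) : Feas (fun p : ℕ × α => f p.2) := hf.rename Ren.snd

theorem add {f g : α → ℕ} (hf : Feas f) (hg : Feas g) : Feas (fun a => f a + g a) := by
  have e : ∀ p : ℕ × ℕ, precFn (fun m : ℕ => m) (fun q => q.2.1 + 1) p = p.1 + p.2 := by
    rintro ⟨n, m⟩
    induction n with
    | zero => simp [precFn_zero]
    | succ n ih => rw [precFn_succ]; simp only at ih ⊢; omega
  have h : Feas (fun p : ℕ × ℕ => p.1 + p.2) :=
    (prec id snd_fst.succ (PolyBd.size.mono fun p => by rw [e]; simp)).congr fun p => (e p).symm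
  exact comp2 h hf hg

theorem mul {f g : α → ℕ} (hf : Feas f) (hg : Feas g) : Feas (fun a => f a * g a) := by
  have e : ∀ p : ℕ × ℕ, precFn (fun _ : ℕ => 0) (fun q => q.2.1 + q.2.2) p = p.1 * p.2 := by
    rintro ⟨n, m⟩
    induction n with
    | zero => simp [precFn_zero]
    | succ n ih => rw [precFn_succ]; simp only at ih ⊢; rw [ih, Nat.succ_mul]
  have h : Feas (fun p : ℕ × ℕ => p.1 * p.2) :=
    (prec zero (snd_fst.add (var (Ren.snd.comp Ren.snd)))
      ((fst.polyBd.mul id.snd.polyBd).mono fun p => (e p).le)).congr fun p => (e p).symm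
  exact comp2 h hf hg

theorem pred {f : α → ℕ} (hf : Feas f) : Feas (fun a => f a - 1) := by
  have h : Feas (fun p : ℕ × ℕ => p.1 - 1) := by
    have e : ∀ p : ℕ × ℕ, precFn (fun _ : ℕ => 0) (fun q => q.1) p = p.1 - 1 := by
      rintro ⟨_ | n, m⟩ <;> rfl
    exact (prec zero fst (fst.polyBd.mono fun p => by rw [e]; omega)).congr fun p => (e p).symm
  exact comp2 h hf hf

theorem sub {f g : α → ℕ} (hf : Feas f) (hg : Feas g) : Feas (fun a => f a - g a) := by
  have e : ∀ p : ℕ × ℕ, precFn (fun m : ℕ => m) (fun q => q.2.1 - 1) p = p.2 - p.1 := by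
    rintro ⟨n, m⟩
    induction n with
    | zero => simp [precFn_zero]
    | succ n ih => rw [precFn_succ]; simp only at ih ⊢; omega
  have h : Feas (fun p : ℕ × ℕ => p.2 - p.1) :=
    (prec id snd_fst.pred (id.snd.polyBd.mono fun p => by rw [e]; omega)).congr
      fun p => (e p).symm
  exact comp2 h hg hf

theorem min' {f g : α → ℕ} (hf : Feas f) (hg : Feas g) : Feas (fun a => min (f a) (g a)) :=
  (hf.sub (hf.sub hg)).congr fun a => by
    rcases le_total (f a) (g a) with h | h
    · rw [Nat.min_eq_left h]; omega
    · rw [Nat.min_eq_right h]; omega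

theorem sum {n : α → ℕ} {f : ℕ × α → ℕ} (hn : Feas n) (hf : Feas f) :
    Feas (fun a => ∑ i ∈ Finset.range (n a), f (i, a)) := by
  have e : ∀ p : ℕ × α, precFn (fun _ : α => 0) (fun q => q.2.1 + f (q.1, q.2.2)) p =
      ∑ i ∈ Finset.range p.1, f (i, p.2) := by
    rintro ⟨n, a⟩
    induction n with
    | zero => simp [precFn_zero]
    | succ n ih => rw [precFn_succ]; simp only at ih ⊢; rw [ih, Finset.sum_range_succ]
  have h : Feas (fun p : ℕ × α => ∑ i ∈ Finset.range p.1, f (i, p.2)) := by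
    refine (prec zero (snd_fst.add (hf.rename (Ren.fst.pair (Ren.snd.comp Ren.snd)))) ?_).congr
      fun p => (e p).symm
    obtain ⟨c, hc⟩ := hf.polyBd.exists_mono
    have hsz : PolyBd (fun p : ℕ × α => Ctx.size p) := PolyBd.size
    refine (fst.polyBd.mul ((hsz.add (PolyBd.const 2)).pow c)).mono fun p => ?_
    rw [e]
    refine (Finset.sum_le_card_nsmul _ _ ((Ctx.size p + 2) ^ c) fun i hi => ?_).trans (by simp)
    have hi := Finset.mem_range.1 hi
    exact hc _ _ (by simp; omega)
  exact letIn h hn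

end Feas

/-- The indicator of a proposition. -/
noncomputable def ind (p : Prop) : ℕ := by
  classical exact if p then 1 else 0

theorem ind_pos {p : Prop} (h : p) : ind p = 1 := by simp [ind, h]

theorem ind_neg {p : Prop} (h : ¬p) : ind p = 0 := by simp [ind, h]

theorem ind_eq_zero {p : Prop} : ind p = 0 ↔ ¬p := by
  by_cases h : p <;> simp [ind, h]

/-- The predicate `p` is decided in polynomial time on unary numbers. -/
def FeasP (p : α → Prop) : Prop := Feas (fun a => ind (p a))

namespace FeasP

theorem congr {p q : α → Prop} (hp : FeasP p) (h : ∀ a, q a ↔ p a) : FeasP q := by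
  rwa [funext fun a => propext (h a)]

theorem not {p : α → Prop} (hp : FeasP p) : FeasP (fun a => ¬p a) :=
  ((Feas.const 1).sub hp).congr fun a => by
    by_cases h : p a
    · rw [ind_pos h, ind_neg (not_not.2 h)]
    · rw [ind_neg h, ind_pos h]

theorem and {p q : α → Prop} (hp : FeasP p) (hq : FeasP q) : FeasP (fun a => p a ∧ q a) :=
  (hp.mul hq).congr fun a => by
    by_cases h : p a <;> by_cases h' : q a <;> simp [ind, h, h']

theorem or {p q : α → Prop} (hp : FeasP p) (hq : FeasP q) : FeasP (fun a => p a ∨ q a) :=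
  (hp.not.and hq.not).not.congr fun a => by tauto

theorem imp {p q : α → Prop} (hp : FeasP p) (hq : FeasP q) : FeasP (fun a => p a → q a) :=
  (hp.not.or hq).congr fun a => by tauto

theorem const (p : Prop) : FeasP (fun _ : α => p) := Feas.const _

theorem eq_zero {f : α → ℕ} (hf : Feas f) : FeasP (fun a => f a = 0) :=
  ((Feas.const 1).sub hf).congr fun a => by
    by_cases h : f a = 0
    · rw [ind_pos h, h]
    · rw [ind_neg h]; omega

theorem le {f g : α → ℕ} (hf : Feas f) (hg : Feas g) : FeasP (fun a => f a ≤ g a) :=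
  (eq_zero (hf.sub hg)).congr fun a => by omega

theorem eq {f g : α → ℕ} (hf : Feas f) (hg : Feas g) : FeasP (fun a => f a = g a) :=
  ((le hf hg).and (le hg hf)).congr fun a => by omega

theorem ball {n : α → ℕ} {p : ℕ × α → Prop} (hn : Feas n) (hp : FeasP p) :
    FeasP (fun a => ∀ i < n a, p (i, a)) :=
  (eq_zero (Feas.sum hn hp.not)).congr fun a => by
    simp [Finset.sum_eq_zero_iff, ind_eq_zero]

theorem bex {n : α → ℕ} {p : ℕ × α → Prop} (hn : Feas n) (hp : FeasP p) :
    FeasP (fun a => ∃ i < n a, p (i, a)) :=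
  (ball hn hp.not).not.congr fun a => by push Not; rfl

end FeasP

open Classical in
/-- The number of `i < n` such that `p i`. -/
noncomputable def countBelow (n : ℕ) (p : ℕ → Prop) : ℕ := ((Finset.range n).filter p).card

theorem sum_ind (n : ℕ) (p : ℕ → Prop) : ∑ i ∈ Finset.range n, ind (p i) = countBelow n p := by
  rw [countBelow, Finset.card_filter]
  exact Finset.sum_congr rfl fun i _ => by simp [ind]

theorem Feas.count {n : α → ℕ} {p : ℕ × α → Prop} (hn : Feas n) (hp : FeasP p) :
    Feas (fun a => countBelow (n a) fun i => p (i, a)) :=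
  (Feas.sum hn hp).congr fun _ => (sum_ind _ _).symm

/-- A number is recovered by counting the smaller ones. Thus a function with a feasible bound is
feasible as soon as its strict lower bounds are recognized. -/
theorem countBelow_eq {n m : ℕ} {p : ℕ → Prop} (h : ∀ i < n, p i ↔ i < m) (hm : m ≤ n) :
    countBelow n p = m := by
  classical
  have : (Finset.range n).filter p = Finset.range m := by
    ext i
    simp only [Finset.mem_filter, Finset.mem_range]
    exact ⟨fun hi => (h i hi.1).1 hi.2, fun hi => ⟨by omega, (h i (by omega)).2 hi⟩⟩
  rw [← Finset.card_range m, ← this, countBelow]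

theorem Feas.half {f : α → ℕ} (hf : Feas f) : Feas (fun a => f a / 2) := by
  refine (Feas.count (p := fun q => 2 * (q.1 + 1) ≤ f q.2) hf
    (FeasP.le ((Feas.const 2).mul Feas.fst.succ) hf.snd)).congr fun a => ?_
  exact (countBelow_eq (fun i _ => by dsimp only; omega) (by omega)).symm

theorem Feas.divPow {f g : α → ℕ} (hf : Feas f) (hg : Feas g) :
    Feas (fun a => f a / 2 ^ g a) := by
  have e : ∀ p : ℕ × ℕ, precFn (fun m : ℕ => m) (fun q => q.2.1 / 2) p = p.2 / 2 ^ p.1 := by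
    rintro ⟨n, m⟩
    induction n with
    | zero => simp [precFn_zero]
    | succ n ih =>
      rw [precFn_succ]
      simp only at ih ⊢
      rw [ih, Nat.div_div_eq_div_mul, pow_succ]
  have h : Feas (fun p : ℕ × ℕ => p.2 / 2 ^ p.1) :=
    (prec id snd_fst.half (id.snd.polyBd.mono fun p => by
      rw [e]; exact Nat.div_le_self _ _)).congr fun p => (e p).symm
  exact comp2 h hg hf

theorem FeasP.testBit {f g : α → ℕ} (hf : Feas f) (hg : Feas g) :
    FeasP (fun a => (f a).testBit (g a) = true) := by
  have h := hf.divPow hg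
  refine (FeasP.eq (h.sub ((Feas.const 2).mul h.half)) (Feas.const 1)).congr fun a => ?_
  rw [Nat.testBit_eq_decide_div_mod_eq, decide_eq_true_iff]
  omega

/-- Powers are feasible when truncated at a feasible bound. The truncation may be done after each
multiplication because the basis is positive, so that truncated powers stay truncated. -/
theorem Feas.minPow {f g B : α → ℕ} (hf : Feas f) (hg : Feas g) (hB : Feas B)
    (h1 : ∀ a, 1 ≤ f a) :
    Feas (fun a => min (f a ^ g a) (B a)) := by
  have e : ∀ n a, precFn (fun a => min 1 (B a))
      (fun q : ℕ × ℕ × α => min (q.2.1 * f q.2.2) (B q.2.2)) (n, a) =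
      min (f a ^ n) (B a) := by
    intro n a
    induction n with
    | zero => simp [precFn_zero]
    | succ n ih =>
      rw [precFn_succ]
      simp only at ih ⊢
      rw [ih, pow_succ]
      rcases le_total (f a ^ n) (B a) with h | h
      · rw [Nat.min_eq_left h]
      · have h2 : B a ≤ B a * f a := Nat.le_mul_of_pos_right _ (h1 a)
        rw [Nat.min_eq_right h, Nat.min_eq_right h2,
          Nat.min_eq_right (h.trans (Nat.le_mul_of_pos_right _ (h1 a)))]
  refine (Feas.prec' hg ((Feas.const 1).min' hB)
    ((snd_fst.mul (hf.rename (Ren.snd.comp Ren.snd))).min' (hB.rename (Ren.snd.comp Ren.snd)))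
    (hB.snd.polyBd.mono fun p => ?_)).congr fun a => (e _ _).symm
  exact (e p.1 p.2).trans_le (Nat.min_le_right _ _)

end Feasible

/-! ### Dominating sets of finite regions of the lattice -/

/-- Adjacency in the lattice `ℕ × ℕ`. -/
def LatAdj (p q : ℕ × ℕ) : Prop :=
  (p.1 = q.1 ∧ (p.2 + 1 = q.2 ∨ q.2 + 1 = p.2)) ∨ (p.2 = q.2 ∧ (p.1 + 1 = q.1 ∨ q.1 + 1 = p.1))

/-- `q` dominates `p`; total domination if `t` is `true`, domination otherwise. -/
def Dominates (t : Bool) (p q : ℕ × ℕ) : Prop := (t = false ∧ p = q) ∨ LatAdj p q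

theorem Dominates.fst_le {t : Bool} {p q : ℕ × ℕ} (h : Dominates t p q) :
    p.1 ≤ q.1 + 1 ∧ q.1 ≤ p.1 + 1 := by
  rcases h with ⟨-, rfl⟩ | h
  · omega
  · unfold LatAdj at h
    omega

theorem dominates_down (t : Bool) (x y : ℕ) : Dominates t (x, y) (x + 1, y) :=
  Or.inr (Or.inr ⟨rfl, Or.inl rfl⟩)

theorem dominates_up (t : Bool) (x y : ℕ) : Dominates t (x + 1, y) (x, y) :=
  Or.inr (Or.inr ⟨rfl, Or.inr rfl⟩)

/-- Every vertex of the region `A` is dominated by an element of `S`. -/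
def Dom (t : Bool) (A S : Finset (ℕ × ℕ)) : Prop := ∀ p ∈ A, ∃ q ∈ S, Dominates t p q

/-- Some vertex of the region `A` is dominated by `v` and by no other element of `S`. -/
def HasPrivate (t : Bool) (A S : Finset (ℕ × ℕ)) (v : ℕ × ℕ) : Prop :=
  ∃ p ∈ A, Dominates t p v ∧ ∀ w ∈ S, Dominates t p w → w = v

/-- `S` is a (total, if `t`) dominating set of the region `A`, which is minimal if `k`. -/
def Sol (t k : Bool) (A S : Finset (ℕ × ℕ)) : Prop :=
  S ⊆ A ∧ Dom t A S ∧ (k = true → ∀ v ∈ S, HasPrivate t A S v)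

open Classical in
/-- The finite set of all `S` such that `Sol t k A S`. -/
noncomputable def sols (t k : Bool) (A : Finset (ℕ × ℕ)) : Finset (Finset (ℕ × ℕ)) :=
  A.powerset.filter (Sol t k A)

theorem mem_sols {t k : Bool} {A S : Finset (ℕ × ℕ)} : S ∈ sols t k A ↔ Sol t k A S := by
  simp only [sols, Finset.mem_filter, Finset.mem_powerset, and_iff_right_iff_imp]
  exact fun h => h.1

/-- A dominating set whose elements in a zone `Q` all have private neighbours contains a minimal
one which agrees with it on `Q`: no dominating subset can do without an element which has a private
neighbour. This allows one to repair a solution far from `Q` while it is kept on `Q`. -/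
theorem exists_sol_agree {t : Bool} (k : Bool) {A U : Finset (ℕ × ℕ)} (hU : U ⊆ A)
    (hd : Dom t A U) (Q : ℕ × ℕ → Prop) (hQ : k = true → ∀ v ∈ U, Q v → HasPrivate t A U v) :
    ∃ S, Sol t k A S ∧ ∀ v, Q v → (v ∈ S ↔ v ∈ U) := by
  cases k with
  | false => exact ⟨U, ⟨hU, hd, fun h => by simp at h⟩, fun _ _ => Iff.rfl⟩
  | true =>
    obtain ⟨S, hSU, hS⟩ := exists_minimal_le_of_wellFoundedLT (fun S => Dom t A S) U hd
    refine ⟨S, ⟨hSU.trans hU, hS.prop, fun _ v hv => ?_⟩, fun v hv => ⟨fun h => hSU h, fun h => ?_⟩⟩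
    · have h1 : ¬Dom t A (S.erase v) := fun h =>
        absurd (hS.le_of_le h (Finset.erase_subset v S) hv) (Finset.notMem_erase v S)
      unfold Dom at h1
      push Not at h1
      obtain ⟨p, hp, h2⟩ := h1
      have h3 : ∀ w ∈ S, Dominates t p w → w = v := fun w hw hpw => by
        by_contra hne
        exact h2 w (Finset.mem_erase.2 ⟨hne, hw⟩) hpw
      obtain ⟨q, hq, hpq⟩ := hS.prop p hp
      exact ⟨p, hp, h3 q hq hpq ▸ hpq, h3⟩
    · obtain ⟨p, hp, -, h2⟩ := hQ rfl v h hv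
      obtain ⟨w, hw, hpw⟩ := hS.prop p hp
      exact h2 w (hSU hw) hpw ▸ hw

/-- The rows from `a` (included) to `b` (excluded) of the strip with `m` columns. -/
def strip (a b m : ℕ) : Finset (ℕ × ℕ) := Finset.Ico a b ×ˢ Finset.range m

theorem mem_strip {a b m : ℕ} {v : ℕ × ℕ} : v ∈ strip a b m ↔ (a ≤ v.1 ∧ v.1 < b) ∧ v.2 < m := by
  simp [strip]

/-- Restriction of a solution to a smaller strip, up to changes close to its ends: two full rows
are added at both ends to repair the domination. A private neighbour of `v` and the vertices which
could dominate it are within distance `2` of `v`; hence five rows are margin enough for the private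
neighbours to survive. -/
theorem Sol.restrict {t k : Bool} {a b a' b' m : ℕ} (ha : a ≤ a') (hb : b' ≤ b) (hab : a' + 2 ≤ b')
    {S : Finset (ℕ × ℕ)} (hS : Sol t k (strip a b m) S) :
    ∃ S', Sol t k (strip a' b' m) S' ∧
      ∀ v : ℕ × ℕ, a' + 5 ≤ v.1 ∧ v.1 + 5 ≤ b' → (v ∈ S' ↔ v ∈ S) := by
  classical
  obtain ⟨hSA, hd, hp⟩ := hS
  set U := (strip a' b' m).filter (fun v => v ∈ S ∨ v.1 ≤ a' + 1 ∨ b' ≤ v.1 + 2) with hU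
  have hmU : ∀ v, v ∈ U ↔ ((a' ≤ v.1 ∧ v.1 < b') ∧ v.2 < m) ∧
      (v ∈ S ∨ v.1 ≤ a' + 1 ∨ b' ≤ v.1 + 2) := fun v => by
    rw [hU, Finset.mem_filter, mem_strip]
  have hSm : ∀ v ∈ S, v.2 < m := fun v hv => (mem_strip.1 (hSA hv)).2
  obtain ⟨S', hS', hagree⟩ := exists_sol_agree (t := t) k (A := strip a' b' m) (U := U)
    (Finset.filter_subset _ _) (by
      rintro ⟨x, y⟩ hxy
      rw [mem_strip] at hxy
      dsimp only at hxy
      by_cases h1 : x = a' ∨ x + 2 = b'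
      · exact ⟨(x + 1, y), (hmU _).2 (by dsimp only; omega), dominates_down t x y⟩
      by_cases h2 : x = a' + 1 ∨ x + 1 = b'
      · obtain ⟨x, rfl⟩ : ∃ z, x = z + 1 := ⟨x - 1, by omega⟩
        exact ⟨(x, y), (hmU _).2 (by dsimp only; omega), dominates_up t x y⟩
      · obtain ⟨q, hq, hR⟩ := hd (x, y) (mem_strip.2 (by dsimp only; omega))
        have h3 := hR.fst_le
        have h4 := hSm q hq
        dsimp only at h3
        exact ⟨q, (hmU _).2 ⟨by omega, Or.inl hq⟩, hR⟩)
    (fun v => a' + 5 ≤ v.1 ∧ v.1 + 5 ≤ b') (by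
      intro hk v hv hQ
      have hvS : v ∈ S := by
        rcases ((hmU v).1 hv).2 with h | h
        · exact h
        · omega
      obtain ⟨p, hpA, hR, hpriv⟩ := hp hk v hvS
      have h1 := hR.fst_le
      have h2 := mem_strip.1 hpA
      refine ⟨p, mem_strip.2 (by omega), hR, fun w hw hpw => hpriv w ?_ hpw⟩
      have h3 := hpw.fst_le
      rcases ((hmU w).1 hw).2 with h | h
      · exact h
      · omega)
  refine ⟨S', hS', fun v hv => (hagree v hv).trans ?_⟩
  rw [hmU]
  constructor
  · rintro ⟨-, h | h⟩
    · exact h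
    · omega
  · intro h
    have := hSm v h
    exact ⟨by omega, Or.inl h⟩

/-- Gluing of solutions on two consecutive strips, up to changes close to their ends. -/
theorem Sol.glue {t k : Bool} {a b c m : ℕ} (hab : a ≤ b) (hbc : b ≤ c) {S₁ S₂ : Finset (ℕ × ℕ)}
    (h₁ : Sol t k (strip a b m) S₁) (h₂ : Sol t k (strip b c m) S₂) :
    ∃ S, Sol t k (strip a c m) S ∧
      (∀ v : ℕ × ℕ, a + 5 ≤ v.1 ∧ v.1 + 5 ≤ b → (v ∈ S ↔ v ∈ S₁)) ∧
      ∀ v : ℕ × ℕ, b + 5 ≤ v.1 ∧ v.1 + 5 ≤ c → (v ∈ S ↔ v ∈ S₂) := by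
  obtain ⟨hA₁, hd₁, hp₁⟩ := h₁
  obtain ⟨hA₂, hd₂, hp₂⟩ := h₂
  have hr₁ : ∀ v ∈ S₁, (a ≤ v.1 ∧ v.1 < b) ∧ v.2 < m := fun v hv => mem_strip.1 (hA₁ hv)
  have hr₂ : ∀ v ∈ S₂, (b ≤ v.1 ∧ v.1 < c) ∧ v.2 < m := fun v hv => mem_strip.1 (hA₂ hv)
  obtain ⟨S, hS, hagree⟩ := exists_sol_agree (t := t) k (A := strip a c m) (U := S₁ ∪ S₂)
    (by
      intro v hv
      rcases Finset.mem_union.1 hv with h | h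
      · have := hr₁ v h
        exact mem_strip.2 (by omega)
      · have := hr₂ v h
        exact mem_strip.2 (by omega))
    (by
      intro p hp
      have h := mem_strip.1 hp
      by_cases hpb : p.1 < b
      · obtain ⟨q, hq, hR⟩ := hd₁ p (mem_strip.2 (by omega))
        exact ⟨q, Finset.mem_union_left _ hq, hR⟩
      · obtain ⟨q, hq, hR⟩ := hd₂ p (mem_strip.2 (by omega))
        exact ⟨q, Finset.mem_union_right _ hq, hR⟩)
    (fun v => (a + 5 ≤ v.1 ∧ v.1 + 5 ≤ b) ∨ (b + 5 ≤ v.1 ∧ v.1 + 5 ≤ c)) (by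
      rintro hk v hv (hQ | hQ)
      · have hv₁ : v ∈ S₁ := by
          rcases Finset.mem_union.1 hv with h | h
          · exact h
          · have := hr₂ v h
            omega
        obtain ⟨p, hpA, hR, hpriv⟩ := hp₁ hk v hv₁
        have h1 := hR.fst_le
        have h2 := mem_strip.1 hpA
        refine ⟨p, mem_strip.2 (by omega), hR, fun w hw hpw => hpriv w ?_ hpw⟩
        have h3 := hpw.fst_le
        rcases Finset.mem_union.1 hw with h | h
        · exact h
        · have := hr₂ w h
          omega
      · have hv₂ : v ∈ S₂ := by
          rcases Finset.mem_union.1 hv with h | h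
          · have := hr₁ v h
            omega
          · exact h
        obtain ⟨p, hpA, hR, hpriv⟩ := hp₂ hk v hv₂
        have h1 := hR.fst_le
        have h2 := mem_strip.1 hpA
        refine ⟨p, mem_strip.2 (by omega), hR, fun w hw hpw => hpriv w ?_ hpw⟩
        have h3 := hpw.fst_le
        rcases Finset.mem_union.1 hw with h | h
        · have := hr₁ w h
          omega
        · exact h)
  refine ⟨S, hS, fun v hv => (hagree v (Or.inl hv)).trans ?_,
    fun v hv => (hagree v (Or.inr hv)).trans ?_⟩
  · rw [Finset.mem_union, or_iff_left]
    intro h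
    have := hr₂ v h
    omega
  · rw [Finset.mem_union, or_iff_right]
    intro h
    have := hr₁ v h
    omega

/-! ### Counting solutions -/

/-- The part of the union of two consecutive strips, with rows from `a` to `b` and from `b` to `c`,
which is close to their ends. -/
def seam (a b c m : ℕ) : Finset (ℕ × ℕ) :=
  (Finset.Ico a (a + 5) ∪ Finset.Ico (b - 5) (b + 5) ∪ Finset.Ico (c - 5) c) ×ˢ Finset.range m

theorem card_seam_le (a b c m : ℕ) : (seam a b c m).card ≤ 20 * m := by
  rw [seam, Finset.card_product, Finset.card_range]
  refine Nat.mul_le_mul_right _ ((Finset.card_union_le _ _).trans ?_)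
  have := Finset.card_union_le (Finset.Ico a (a + 5)) (Finset.Ico (b - 5) (b + 5))
  simp only [Nat.card_Ico] at this ⊢
  omega

theorem mem_seam_or {a b c m : ℕ} {v : ℕ × ℕ} (hv : v ∈ strip a c m) :
    v ∈ seam a b c m ∨ (a + 5 ≤ v.1 ∧ v.1 + 5 ≤ b) ∨ (b + 5 ≤ v.1 ∧ v.1 + 5 ≤ c) := by
  have := mem_strip.1 hv
  simp only [seam, Finset.mem_product, Finset.mem_union, Finset.mem_Ico, Finset.mem_range]
  omega

theorem card_powerset_seam_le (a b c m : ℕ) : (seam a b c m).powerset.card ≤ 2 ^ (20 * m) := by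
  rw [Finset.card_powerset]
  exact Nat.pow_le_pow_right two_pos (card_seam_le a b c m)

/-- A solution on a strip is determined by its restrictions to two consecutive parts and by its
trace on the seam. -/
theorem card_sols_strip_le {t k : Bool} {a b c m : ℕ} (hab : a + 2 ≤ b) (hbc : b + 2 ≤ c) :
    (sols t k (strip a c m)).card ≤
      (sols t k (strip a b m)).card * (sols t k (strip b c m)).card * 2 ^ (20 * m) := by
  classical
  have h1 : ∀ S : Finset (ℕ × ℕ), ∃ S', S ∈ sols t k (strip a c m) →
      S' ∈ sols t k (strip a b m) ∧
        ∀ v : ℕ × ℕ, a + 5 ≤ v.1 ∧ v.1 + 5 ≤ b → (v ∈ S' ↔ v ∈ S) := fun S => by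
    by_cases hS : S ∈ sols t k (strip a c m)
    · obtain ⟨S', h, h'⟩ := (mem_sols.1 hS).restrict le_rfl (by omega : b ≤ c) hab
      exact ⟨S', fun _ => ⟨mem_sols.2 h, h'⟩⟩
    · exact ⟨∅, fun h => absurd h hS⟩
  have h2 : ∀ S : Finset (ℕ × ℕ), ∃ S', S ∈ sols t k (strip a c m) →
      S' ∈ sols t k (strip b c m) ∧
        ∀ v : ℕ × ℕ, b + 5 ≤ v.1 ∧ v.1 + 5 ≤ c → (v ∈ S' ↔ v ∈ S) := fun S => by
    by_cases hS : S ∈ sols t k (strip a c m)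
    · obtain ⟨S', h, h'⟩ := (mem_sols.1 hS).restrict (by omega : a ≤ b) le_rfl hbc
      exact ⟨S', fun _ => ⟨mem_sols.2 h, h'⟩⟩
    · exact ⟨∅, fun h => absurd h hS⟩
  choose f₁ hf₁ using h1
  choose f₂ hf₂ using h2
  have key := Finset.card_le_card_of_injOn
    (s := sols t k (strip a c m))
    (t := (sols t k (strip a b m) ×ˢ sols t k (strip b c m)) ×ˢ (seam a b c m).powerset)
    (fun S => ((f₁ S, f₂ S), S ∩ seam a b c m))
    (fun S hS => by
      have hS : S ∈ sols t k (strip a c m) := hS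
      simp only [Finset.coe_product, Set.mem_prod, Finset.mem_coe, Finset.mem_powerset]
      exact ⟨⟨(hf₁ S hS).1, (hf₂ S hS).1⟩, Finset.inter_subset_right⟩)
    (by
      have hsub : ∀ S ∈ sols t k (strip a c m), ∀ S' ∈ sols t k (strip a c m),
          f₁ S = f₁ S' → f₂ S = f₂ S' → S ∩ seam a b c m = S' ∩ seam a b c m → S ⊆ S' := by
        intro S hS S' hS' e₁ e₂ e₃ v hv
        rcases mem_seam_or (b := b) ((mem_sols.1 hS).1 hv) with h | h | h
        · exact (Finset.mem_inter.1 (e₃ ▸ Finset.mem_inter.2 ⟨hv, h⟩)).1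
        · exact ((hf₁ S' hS').2 v h).1 (e₁ ▸ ((hf₁ S hS).2 v h).2 hv)
        · exact ((hf₂ S' hS').2 v h).1 (e₂ ▸ ((hf₂ S hS).2 v h).2 hv)
      intro S hS S' hS' e
      simp only [Prod.mk.injEq] at e
      exact (hsub S hS S' hS' e.1.1 e.1.2 e.2).antisymm
        (hsub S' hS' S hS e.1.1.symm e.1.2.symm e.2.symm))
  rw [Finset.card_product, Finset.card_product] at key
  exact key.trans (Nat.mul_le_mul_left _ (card_powerset_seam_le a b c m))

/-- Two solutions on consecutive strips are determined by the solution obtained by gluing them and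
by their trace on the seam. -/
theorem card_sols_mul_le {t k : Bool} {a b c m : ℕ} (hab : a ≤ b) (hbc : b ≤ c) :
    (sols t k (strip a b m)).card * (sols t k (strip b c m)).card ≤
      (sols t k (strip a c m)).card * 2 ^ (20 * m) := by
  classical
  have h1 : ∀ p : Finset (ℕ × ℕ) × Finset (ℕ × ℕ), ∃ S,
      p ∈ sols t k (strip a b m) ×ˢ sols t k (strip b c m) → S ∈ sols t k (strip a c m) ∧
      (∀ v : ℕ × ℕ, a + 5 ≤ v.1 ∧ v.1 + 5 ≤ b → (v ∈ S ↔ v ∈ p.1)) ∧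
      ∀ v : ℕ × ℕ, b + 5 ≤ v.1 ∧ v.1 + 5 ≤ c → (v ∈ S ↔ v ∈ p.2) := fun p => by
    by_cases hp : p ∈ sols t k (strip a b m) ×ˢ sols t k (strip b c m)
    · have hp' := Finset.mem_product.1 hp
      obtain ⟨S, h, h'⟩ := (mem_sols.1 hp'.1).glue hab hbc (mem_sols.1 hp'.2)
      exact ⟨S, fun _ => ⟨mem_sols.2 h, h'⟩⟩
    · exact ⟨∅, fun h => absurd h hp⟩
  choose f hf using h1
  have key := Finset.card_le_card_of_injOn
    (s := sols t k (strip a b m) ×ˢ sols t k (strip b c m))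
    (t := sols t k (strip a c m) ×ˢ (seam a b c m).powerset)
    (fun p => (f p, (p.1 ∪ p.2) ∩ seam a b c m))
    (fun p hp => by
      have hp : p ∈ sols t k (strip a b m) ×ˢ sols t k (strip b c m) := hp
      simp only [Finset.coe_product, Set.mem_prod, Finset.mem_coe, Finset.mem_powerset]
      exact ⟨(hf p hp).1, Finset.inter_subset_right⟩)
    (by
      have hsub : ∀ p ∈ sols t k (strip a b m) ×ˢ sols t k (strip b c m),
          ∀ p' ∈ sols t k (strip a b m) ×ˢ sols t k (strip b c m), f p = f p' →
          (p.1 ∪ p.2) ∩ seam a b c m = (p'.1 ∪ p'.2) ∩ seam a b c m →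
          p.1 ⊆ p'.1 ∧ p.2 ⊆ p'.2 := by
        intro p hp p' hp' e₁ e₂
        have q := Finset.mem_product.1 hp
        have q' := Finset.mem_product.1 hp'
        have r₁ := fun (v) (hv : v ∈ p.1) => mem_strip.1 ((mem_sols.1 q.1).1 hv)
        have r₂ := fun (v) (hv : v ∈ p.2) => mem_strip.1 ((mem_sols.1 q.2).1 hv)
        have r₁' := fun (v) (hv : v ∈ p'.1) => mem_strip.1 ((mem_sols.1 q'.1).1 hv)
        have r₂' := fun (v) (hv : v ∈ p'.2) => mem_strip.1 ((mem_sols.1 q'.2).1 hv)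
        constructor
        · intro v hv
          have hr := r₁ v hv
          rcases mem_seam_or (a := a) (b := b) (c := c) (mem_strip.2 (by omega : _ ∧ v.2 < m))
            with h | h | h
          · have h3 := Finset.mem_inter.1
              (e₂ ▸ Finset.mem_inter.2 ⟨Finset.mem_union_left p.2 hv, h⟩)
            rcases Finset.mem_union.1 h3.1 with h4 | h4
            · exact h4
            · have := r₂' v h4
              omega
          · exact ((hf p' hp').2.1 v h).1 (e₁ ▸ ((hf p hp).2.1 v h).2 hv)
          · omega
        · intro v hv
          have hr := r₂ v hv
          rcases mem_seam_or (a := a) (b := b) (c := c) (mem_strip.2 (by omega : _ ∧ v.2 < m))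
            with h | h | h
          · have h3 := Finset.mem_inter.1
              (e₂ ▸ Finset.mem_inter.2 ⟨Finset.mem_union_right p.1 hv, h⟩)
            rcases Finset.mem_union.1 h3.1 with h4 | h4
            · have := r₁' v h4
              omega
            · exact h4
          · omega
          · exact ((hf p' hp').2.2 v h).1 (e₁ ▸ ((hf p hp).2.2 v h).2 hv)
      intro p hp p' hp' e
      simp only [Prod.mk.injEq] at e
      have h1 := hsub p hp p' hp' e.1 e.2
      have h2 := hsub p' hp' p hp e.1.symm e.2.symm
      exact Prod.ext (h1.1.antisymm h2.1) (h1.2.antisymm h2.2))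
  rw [Finset.card_product, Finset.card_product] at key
  exact key.trans (Nat.mul_le_mul_left _ (card_powerset_seam_le a b c m))

/-- Solutions are transported by embeddings of the lattice which respect domination. -/
theorem card_sols_map {t k : Bool} (e : ℕ × ℕ ↪ ℕ × ℕ)
    (he : ∀ p q, Dominates t (e p) (e q) ↔ Dominates t p q) (A : Finset (ℕ × ℕ)) :
    (sols t k (A.map e)).card = (sols t k A).card := by
  classical
  have h : ∀ S, Sol t k (A.map e) (S.map e) ↔ Sol t k A S := by
    intro S
    simp only [Sol, Dom, HasPrivate, Finset.map_subset_map, Finset.mem_map, forall_exists_index,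
      and_imp, forall_apply_eq_imp_iff₂, exists_exists_and_eq_and, he, e.injective.eq_iff]
  refine Eq.trans (congrArg _ ?_) (Finset.card_map (Finset.mapEmbedding e).toEmbedding)
  ext T
  simp only [Finset.mem_map, mem_sols, RelEmbedding.coe_toEmbedding, Finset.mapEmbedding_apply]
  constructor
  · intro hT
    obtain ⟨S, -, rfl⟩ := Finset.subset_map_iff.1 hT.1
    exact ⟨S, (h S).1 hT, rfl⟩
  · rintro ⟨S, hS, rfl⟩
    exact (h S).2 hS

/-- The number of (total, if `t`; minimal, if `k`) dominating sets of the `n × m` grid. -/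
noncomputable def numSol (t k : Bool) (n m : ℕ) : ℕ := (sols t k (strip 0 n m)).card

theorem numSol_strip (t k : Bool) (b n m : ℕ) :
    (sols t k (strip b (b + n) m)).card = numSol t k n m := by
  have he : Function.Injective (fun p : ℕ × ℕ => (b + p.1, p.2)) := by
    rintro ⟨x, y⟩ ⟨x', y'⟩ h
    simp only [Prod.mk.injEq] at h ⊢
    omega
  refine Eq.trans (congrArg (fun A => (sols t k A).card) ?_)
    (card_sols_map (t := t) (k := k) ⟨_, he⟩ (fun p q => ?_) (strip 0 n m))
  · ext v
    simp only [mem_strip, Finset.mem_map, Function.Embedding.coeFn_mk]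
    constructor
    · intro h
      exact ⟨(v.1 - b, v.2), by dsimp only; omega, Prod.ext (by dsimp only; omega) rfl⟩
    · rintro ⟨p, hp, rfl⟩
      dsimp only
      omega
  · simp only [Dominates, LatAdj, Function.Embedding.coeFn_mk, Prod.ext_iff]
    exact or_congr (and_congr_right fun _ => by omega) (by omega)

theorem numSol_swap (t k : Bool) (n m : ℕ) : numSol t k n m = numSol t k m n := by
  refine Eq.trans (congrArg (fun A => (sols t k A).card) ?_)
    (card_sols_map (t := t) (k := k) ⟨Prod.swap, Prod.swap_injective⟩ (fun p q => ?_)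
      (strip 0 m n))
  · ext v
    simp only [mem_strip, Finset.mem_map, Function.Embedding.coeFn_mk]
    constructor
    · intro h
      exact ⟨v.swap, by simp only [Prod.fst_swap, Prod.snd_swap]; omega, Prod.swap_swap v⟩
    · rintro ⟨p, hp, rfl⟩
      simp only [Prod.fst_swap, Prod.snd_swap]
      omega
  · simp only [Dominates, LatAdj, Function.Embedding.coeFn_mk, Prod.fst_swap, Prod.snd_swap,
      Prod.ext_iff]
    exact or_congr (and_congr_right fun _ => and_comm) or_comm

theorem numSol_add_le {t k : Bool} {n₁ n₂ : ℕ} (h₁ : 2 ≤ n₁) (h₂ : 2 ≤ n₂) (m : ℕ) :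
    numSol t k (n₁ + n₂) m ≤ numSol t k n₁ m * numSol t k n₂ m * 2 ^ (20 * m) := by
  have := card_sols_strip_le (t := t) (k := k) (a := 0) (b := n₁) (c := n₁ + n₂) (m := m)
    (by omega) (by omega)
  rwa [numSol_strip] at this

theorem numSol_mul_le (t k : Bool) (n₁ n₂ m : ℕ) :
    numSol t k n₁ m * numSol t k n₂ m ≤ numSol t k (n₁ + n₂) m * 2 ^ (20 * m) := by
  have := card_sols_mul_le (t := t) (k := k) (a := 0) (b := n₁) (c := n₁ + n₂) (m := m)
    (by omega) (by omega)
  rwa [numSol_strip] at this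

theorem numSol_le (t k : Bool) (n m : ℕ) : numSol t k n m ≤ 2 ^ (n * m) := by
  classical
  refine (Finset.card_filter_le _ _).trans ?_
  rw [Finset.card_powerset, strip, Finset.card_product]
  simp

theorem numSol_pos {t k : Bool} {n : ℕ} (hn : 2 ≤ n) (m : ℕ) : 0 < numSol t k n m := by
  obtain ⟨S, hS, -⟩ := exists_sol_agree (t := t) k (A := strip 0 n m) subset_rfl (by
      rintro ⟨x, y⟩ hxy
      have h := mem_strip.1 hxy
      rcases x with _ | x
      · exact ⟨(1, y), mem_strip.2 (by dsimp only at h ⊢; omega), dominates_down t 0 y⟩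
      · exact ⟨(x, y), mem_strip.2 (by dsimp only at h ⊢; omega), dominates_up t x y⟩)
    (fun _ => False) (fun _ _ _ h => h.elim)
  exact Finset.card_pos.2 ⟨S, mem_sols.2 hS⟩

/-! ### Exponentially many solutions -/

/-- The offsets, in a `5 × 5` block, of its centre and of the four neighbours of the centre. -/
def plus : Finset (ℕ × ℕ) := {(2, 2), (1, 2), (3, 2), (2, 1), (2, 3)}

/-- In a block, every cell except the centre has a neighbour in the same block outside of the
plus. -/
theorem exists_adj_notMem_plus : ∀ a < 5, ∀ b < 5, (a, b) ≠ (2, 2) → ∃ a' < 5, ∃ b' < 5,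
    ((a = a' ∧ (b + 1 = b' ∨ b' + 1 = b)) ∨ (b = b' ∧ (a + 1 = a' ∨ a' + 1 = a))) ∧
      (a', b') ∉ plus := by
  have h : ∀ a ∈ Finset.range 5, ∀ b ∈ Finset.range 5, (a, b) ≠ (2, 2) →
      ∃ a' ∈ Finset.range 5, ∃ b' ∈ Finset.range 5,
        ((a = a' ∧ (b + 1 = b' ∨ b' + 1 = b)) ∨ (b = b' ∧ (a + 1 = a' ∨ a' + 1 = a))) ∧
          (a', b') ∉ plus := by
    decide
  simpa only [Finset.mem_range] using h

/-- Membership in the dominating set of a square of `5 × 5` blocks which contains, of each plus in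
the centre of a block, only the top cell (if the block is in `x`) or the bottom cell, and everything
outside of the pluses. -/
def InPattern (x : Finset (ℕ × ℕ)) (v : ℕ × ℕ) : Prop :=
  (v.1 % 5, v.2 % 5) ∉ plus ∨
    ((v.1 % 5 = 1 ∧ v.2 % 5 = 2) ∧ (v.1 / 5, v.2 / 5) ∈ x) ∨
    ((v.1 % 5 = 3 ∧ v.2 % 5 = 2) ∧ (v.1 / 5, v.2 / 5) ∉ x)

/-- The sets `InPattern x` are dominating. In each plus they have one cell, the only one which
dominates the centre of the block (also in the total sense), so that this cell has the centre as
private neighbour and is kept in a minimal solution. Hence the block pattern `x` can be read off the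
solution. -/
theorem two_pow_le_numSol (t k : Bool) (n : ℕ) : 2 ^ (n * n) ≤ numSol t k (5 * n) (5 * n) := by
  classical
  set A := strip 0 (5 * n) (5 * n) with hA
  have hmA : ∀ v, v ∈ A ↔ v.1 < 5 * n ∧ v.2 < 5 * n := fun v => by
    rw [hA, mem_strip]
    omega
  have key : ∀ x : Finset (ℕ × ℕ), ∃ S, Sol t k A S ∧ ∀ v : ℕ × ℕ,
      ((v.1 % 5 = 1 ∨ v.1 % 5 = 3) ∧ v.2 % 5 = 2) → (v ∈ S ↔ v ∈ A.filter (InPattern x)) := by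
    intro x
    refine exists_sol_agree k (Finset.filter_subset _ _) ?_ _ ?_
    · rintro ⟨r, c⟩ hp
      rw [hmA] at hp
      dsimp only at hp
      by_cases h : (r % 5, c % 5) = (2, 2)
      · simp only [Prod.mk.injEq] at h
        by_cases hx : (r / 5, c / 5) ∈ x
        · refine ⟨(r - 1, c), Finset.mem_filter.2 ⟨(hmA _).2 (by dsimp only; omega), ?_⟩, ?_⟩
          · refine Or.inr (Or.inl ⟨by dsimp only; omega, ?_⟩)
            rwa [show (r - 1) / 5 = r / 5 by omega]
          · obtain ⟨r, rfl⟩ : ∃ z, r = z + 1 := ⟨r - 1, by omega⟩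
            exact dominates_up t r c
        · refine ⟨(r + 1, c), Finset.mem_filter.2 ⟨(hmA _).2 (by dsimp only; omega), ?_⟩,
            dominates_down t r c⟩
          refine Or.inr (Or.inr ⟨by dsimp only; omega, ?_⟩)
          rwa [show (r + 1) / 5 = r / 5 by omega]
      · obtain ⟨a', ha', b', hb', hadj, hplus⟩ := exists_adj_notMem_plus (r % 5)
          (Nat.mod_lt _ (by norm_num)) (c % 5) (Nat.mod_lt _ (by norm_num)) h
        refine ⟨(5 * (r / 5) + a', 5 * (c / 5) + b'), Finset.mem_filter.2
          ⟨(hmA _).2 (by dsimp only; omega), Or.inl ?_⟩, Or.inr ?_⟩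
        · dsimp only
          rwa [show (5 * (r / 5) + a') % 5 = a' by omega,
            show (5 * (c / 5) + b') % 5 = b' by omega]
        · unfold LatAdj
          dsimp only
          omega
    · rintro - ⟨r, c⟩ hv hQ
      dsimp only at hQ
      have hv' := Finset.mem_filter.1 hv
      have hvA := (hmA _).1 hv'.1
      dsimp only at hvA
      have hrow : ∃ i j, r / 5 = i ∧ c / 5 = j := ⟨_, _, rfl, rfl⟩
      obtain ⟨i, j, hi, hj⟩ := hrow
      have hpat : ∀ w : ℕ × ℕ, w ∈ A.filter (InPattern x) →
          Dominates t (5 * i + 2, 5 * j + 2) w →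
          (w = (5 * i + 1, 5 * j + 2) ∧ (i, j) ∈ x) ∨
            (w = (5 * i + 3, 5 * j + 2) ∧ (i, j) ∉ x) := by
        rintro ⟨a, b⟩ hw hd
        have hpat := (Finset.mem_filter.1 hw).2
        have hcase : (a = 5 * i + 2 ∧ b = 5 * j + 2) ∨ (a = 5 * i + 1 ∧ b = 5 * j + 2) ∨
            (a = 5 * i + 3 ∧ b = 5 * j + 2) ∨ (a = 5 * i + 2 ∧ b = 5 * j + 1) ∨
            (a = 5 * i + 2 ∧ b = 5 * j + 3) := by
          rcases hd with ⟨-, h⟩ | h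
          · simp only [Prod.mk.injEq] at h
            omega
          · unfold LatAdj at h
            dsimp only at h
            omega
        have e1 : (5 * i + 1) / 5 = i := by omega
        have e3 : (5 * i + 3) / 5 = i := by omega
        have e2 : (5 * j + 2) / 5 = j := by omega
        rcases hcase with ⟨rfl, rfl⟩ | ⟨rfl, rfl⟩ | ⟨rfl, rfl⟩ | ⟨rfl, rfl⟩ | ⟨rfl, rfl⟩ <;>
          simp_all [InPattern, plus, Nat.add_mod]
      have hd : Dominates t (5 * i + 2, 5 * j + 2) (r, c) := by
        refine Or.inr ?_
        unfold LatAdj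
        dsimp only
        omega
      refine ⟨(5 * i + 2, 5 * j + 2), (hmA _).2 (by dsimp only; omega), hd, fun w hw hpw => ?_⟩
      rcases hpat w hw hpw with ⟨h1, h2⟩ | ⟨h1, h2⟩ <;>
      rcases hpat _ hv hd with ⟨h3, h4⟩ | ⟨h3, h4⟩
      · rw [h1, h3]
      · exact absurd h2 h4
      · exact absurd h4 h2
      · rw [h1, h3]
  choose f hf using key
  have hinj := Finset.card_le_card_of_injOn
    (s := (Finset.range n ×ˢ Finset.range n).powerset) (t := sols t k A) f
    (fun x _ => mem_sols.2 (hf x).1) (by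
      have hmem : ∀ x ∈ (Finset.range n ×ˢ Finset.range n).powerset, ∀ i j, (i, j) ∈ x ↔
          (i < n ∧ j < n) ∧ (5 * i + 1, 5 * j + 2) ∈ f x := by
        intro x hx i j
        rw [(hf x).2 _ (by dsimp only; omega), Finset.mem_filter, hmA]
        have e : InPattern x (5 * i + 1, 5 * j + 2) ↔ (i, j) ∈ x := by
          have e1 : (5 * i + 1) / 5 = i := by omega
          have e2 : (5 * j + 2) / 5 = j := by omega
          simp [InPattern, plus, Nat.add_mod, e1, e2]
        rw [e]
        constructor
        · intro h
          have := Finset.mem_product.1 (Finset.mem_powerset.1 hx h)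
          simp only [Finset.mem_range] at this
          exact ⟨this, by dsimp only; omega, h⟩
        · exact fun h => h.2.2
      intro x hx y hy e
      ext ⟨i, j⟩
      rw [hmem x hx, hmem y hy]
      have e : f x = f y := e
      rw [e])
  rw [Finset.card_powerset, Finset.card_product, Finset.card_range] at hinj
  exact hinj

/-! ### The growth rate -/

/-- The binary logarithm of the number of solutions on the `n × m` grid. -/
noncomputable def logSol (t k : Bool) (n m : ℕ) : ℝ := Real.logb 2 (numSol t k n m)

theorem logSol_swap (t k : Bool) (n m : ℕ) : logSol t k n m = logSol t k m n := by
  rw [logSol, numSol_swap, logSol]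

theorem logSol_le (t k : Bool) {n : ℕ} (hn : 2 ≤ n) (m : ℕ) : logSol t k n m ≤ n * m := by
  have h : ((numSol t k n m : ℕ) : ℝ) ≤ 2 ^ (n * m) := by exact_mod_cast numSol_le t k n m
  have h0 : (0 : ℝ) < numSol t k n m := by exact_mod_cast numSol_pos hn m
  have := Real.logb_le_logb_of_le one_lt_two h0 h
  rwa [Real.logb_pow, Real.logb_self_eq_one one_lt_two, mul_one, Nat.cast_mul] at this

theorem abs_logSol_add_sub_le (t k : Bool) {n₁ n₂ : ℕ} (h₁ : 2 ≤ n₁) (h₂ : 2 ≤ n₂) (m : ℕ) :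
    |logSol t k (n₁ + n₂) m - (logSol t k n₁ m + logSol t k n₂ m)| ≤ 20 * m := by
  have p₁ : (0 : ℝ) < numSol t k n₁ m := by exact_mod_cast numSol_pos h₁ m
  have p₂ : (0 : ℝ) < numSol t k n₂ m := by exact_mod_cast numSol_pos h₂ m
  have p : (0 : ℝ) < numSol t k (n₁ + n₂) m := by exact_mod_cast numSol_pos (by omega) m
  have e1 : ((numSol t k (n₁ + n₂) m : ℕ) : ℝ) ≤
      numSol t k n₁ m * numSol t k n₂ m * 2 ^ (20 * m) := by
    exact_mod_cast numSol_add_le h₁ h₂ m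
  have e2 : (numSol t k n₁ m * numSol t k n₂ m : ℝ) ≤ numSol t k (n₁ + n₂) m * 2 ^ (20 * m) := by
    exact_mod_cast numSol_mul_le t k n₁ n₂ m
  have hp : (0 : ℝ) < 2 ^ (20 * m) := by positivity
  have hl : Real.logb 2 (2 ^ (20 * m)) = 20 * m := by
    rw [Real.logb_pow, Real.logb_self_eq_one one_lt_two]
    push_cast
    ring
  have l1 := Real.logb_le_logb_of_le one_lt_two p e1
  have l2 := Real.logb_le_logb_of_le one_lt_two (mul_pos p₁ p₂) e2
  rw [Real.logb_mul (mul_pos p₁ p₂).ne' hp.ne', Real.logb_mul p₁.ne' p₂.ne', hl] at l1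
  rw [Real.logb_mul p₁.ne' p₂.ne', Real.logb_mul p.ne' hp.ne', hl] at l2
  unfold logSol
  rw [abs_le]
  constructor <;> linarith

theorem abs_logSol_mul_sub_le (t k : Bool) {n : ℕ} (hn : 2 ≤ n) (m : ℕ) {i : ℕ} (hi : 1 ≤ i) :
    |logSol t k (i * n) m - i * logSol t k n m| ≤ 20 * i * m := by
  induction i, hi using Nat.le_induction with
  | base =>
    simp only [one_mul, Nat.cast_one, sub_self, abs_zero]
    positivity
  | succ i hi ih =>
    have h := abs_logSol_add_sub_le t k (n₁ := i * n) (n₂ := n) (by nlinarith) hn m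
    rw [Nat.succ_mul]
    push_cast
    rw [abs_le] at h ih ⊢
    constructor <;> nlinarith

/-- Additivity in the rows and, by symmetry, in the columns. -/
theorem abs_logSol_mul_mul_sub_le (t k : Bool) {n m i j : ℕ} (hn : 2 ≤ n) (hm : 2 ≤ m)
    (hi : 1 ≤ i) (hj : 1 ≤ j) :
    |logSol t k (i * n) (j * m) - i * j * logSol t k n m| ≤ 20 * (i * j) * (n + m) := by
  have h1 := abs_logSol_mul_sub_le t k hn (j * m) hi
  have h2 := abs_logSol_mul_sub_le t k hm n hj
  rw [logSol_swap t k (j * m), logSol_swap t k m] at h2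
  have h3 : |(i : ℝ) * (logSol t k n (j * m) - j * logSol t k n m)| ≤ i * (20 * j * n) := by
    rw [abs_mul, Nat.abs_cast]
    exact mul_le_mul_of_nonneg_left h2 (Nat.cast_nonneg i)
  push_cast at h1
  rw [abs_le] at h1 h3 ⊢
  constructor <;> nlinarith

/-- The logarithm of the number of solutions per vertex. -/
noncomputable def density (t k : Bool) (n m : ℕ) : ℝ := logSol t k n m / (n * m)

theorem abs_density_sub_le (t k : Bool) {n m i j : ℕ} (hn : 2 ≤ n) (hm : 2 ≤ m)
    (hi : 1 ≤ i) (hj : 1 ≤ j) :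
    |density t k (i * n) (j * m) - density t k n m| ≤ 20 * (1 / n + 1 / m) := by
  have h := abs_logSol_mul_mul_sub_le t k hn hm hi hj
  have n0 : (0 : ℝ) < n := by exact_mod_cast (by omega : 0 < n)
  have m0 : (0 : ℝ) < m := by exact_mod_cast (by omega : 0 < m)
  have i0 : (0 : ℝ) < i := by exact_mod_cast hi
  have j0 : (0 : ℝ) < j := by exact_mod_cast hj
  have e : density t k (i * n) (j * m) - density t k n m =
      (logSol t k (i * n) (j * m) - i * j * logSol t k n m) / (i * j * (n * m)) := by
    unfold density
    push_cast
    field_simp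
  rw [e, abs_div, abs_of_pos (by positivity : (0 : ℝ) < i * j * (n * m)),
    div_le_iff₀ (by positivity)]
  refine h.trans (le_of_eq ?_)
  field_simp
  ring

/-- Both densities are compared with that of the `n n' × m m'` grid. -/
theorem abs_density_sub_density_le (t k : Bool) {n m n' m' : ℕ} (hn : 2 ≤ n) (hm : 2 ≤ m)
    (hn' : 2 ≤ n') (hm' : 2 ≤ m') :
    |density t k n m - density t k n' m'| ≤
      20 * (1 / n + 1 / m) + 20 * (1 / n' + 1 / m') := by
  have h1 := abs_density_sub_le t k (i := n') (j := m') hn hm (by omega) (by omega)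
  have h2 := abs_density_sub_le t k (i := n) (j := m) hn' hm' (by omega) (by omega)
  rw [mul_comm n n', mul_comm m m'] at h2
  rw [abs_le] at h1 h2 ⊢
  constructor <;> linarith

open Filter Topology in
theorem exists_density_limit (t k : Bool) : ∃ h : ℝ, ∀ n m : ℕ, 2 ≤ n → 2 ≤ m →
    |density t k n m - h| ≤ 20 * (1 / n + 1 / m) := by
  have hb : ∀ ε > (0 : ℝ), ∃ N : ℕ, 2 ≤ N ∧ ∀ n ≥ N, (40 : ℝ) * (1 / n) < ε := by
    intro ε hε
    obtain ⟨N, hN⟩ := exists_nat_gt (40 / ε)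
    refine ⟨N + 2, by omega, fun n hn => ?_⟩
    have h0 : (0 : ℝ) < n := by exact_mod_cast (by omega : 0 < n)
    have h1 : (N : ℝ) ≤ n := by exact_mod_cast (by omega : N ≤ n)
    rw [mul_one_div, div_lt_iff₀ h0]
    rw [div_lt_iff₀ hε] at hN
    nlinarith
  have hc : CauchySeq (fun n => density t k n n) := by
    refine Metric.cauchySeq_iff'.2 fun ε hε => ?_
    obtain ⟨N, hN2, hN⟩ := hb (ε / 2) (by positivity)
    refine ⟨N, fun n hn => ?_⟩
    have h1 := hN n hn
    have h2 := hN N le_rfl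
    have h3 := abs_density_sub_density_le t k (hN2.trans hn) (hN2.trans hn) hN2 hN2
    rw [Real.dist_eq]
    linarith
  obtain ⟨h, hh⟩ := cauchySeq_tendsto_of_complete hc
  refine ⟨h, fun n m hn hm => le_of_forall_pos_le_add fun ε hε => ?_⟩
  obtain ⟨N, hN2, hN⟩ := hb (ε / 2) (by positivity)
  obtain ⟨M, hM⟩ := Metric.tendsto_atTop.1 hh (ε / 2) (by positivity)
  have h1 := hM (max N M) (le_max_right _ _)
  have h2 := hN (max N M) (le_max_left _ _)
  have h3 := abs_density_sub_density_le t k hn hm (hN2.trans (le_max_left N M))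
    (hN2.trans (le_max_left N M))
  rw [Real.dist_eq] at h1
  have h4 := abs_sub_le (density t k n m) (density t k (max N M) (max N M)) h
  linarith

/-- The limit of `density`: the binary logarithm of the growth rate. -/
noncomputable def limitDensity (t k : Bool) : ℝ := (exists_density_limit t k).choose

theorem abs_density_sub_limit_le (t k : Bool) {n m : ℕ} (hn : 2 ≤ n) (hm : 2 ≤ m) :
    |density t k n m - limitDensity t k| ≤ 20 * (1 / n + 1 / m) :=
  (exists_density_limit t k).choose_spec n m hn hm

theorem limitDensity_le_one (t k : Bool) : limitDensity t k ≤ 1 := by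
  refine le_of_forall_pos_le_add fun ε hε => ?_
  obtain ⟨N, hN⟩ := exists_nat_gt (40 / ε)
  have h0 : (0 : ℝ) < (N + 2 : ℕ) := by positivity
  have h1 := (abs_le.1 (abs_density_sub_limit_le t k (n := N + 2) (m := N + 2) (by omega)
    (by omega))).1
  have h2 : density t k (N + 2) (N + 2) ≤ 1 := by
    refine div_le_one_of_le₀ (logSol_le t k (by omega) _) (by positivity)
  have h3 : 40 * (1 / ((N + 2 : ℕ) : ℝ)) ≤ ε := by
    rw [mul_one_div, div_le_iff₀ h0]
    rw [div_lt_iff₀ hε] at hN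
    push_cast
    nlinarith
  linarith

/-- The density is at least `1 / 25` on the square grid of side `5 r`, and on the square of side
`5000` it differs from its limit by at most `40 / 5000`. -/
theorem limitDensity_pos (t k : Bool) : 0 < limitDensity t k := by
  have h1 := (abs_le.1 (abs_density_sub_limit_le t k (n := 5 * 1000) (m := 5 * 1000) (by norm_num)
    (by norm_num))).2
  have h2 : (1 : ℝ) / 25 ≤ density t k (5 * 1000) (5 * 1000) := by
    have h3 : ((2 ^ (1000 * 1000) : ℕ) : ℝ) ≤ numSol t k (5 * 1000) (5 * 1000) :=
      Nat.cast_le.2 (two_pow_le_numSol t k 1000)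
    rw [Nat.cast_pow] at h3
    have h4 := Real.logb_le_logb_of_le one_lt_two (by positivity) h3
    rw [Nat.cast_ofNat, Real.logb_pow, Real.logb_self_eq_one one_lt_two, mul_one] at h4
    unfold density logSol
    rw [le_div_iff₀ (by positivity)]
    refine le_trans (le_of_eq ?_) h4
    push_cast
    norm_num
  push_cast at h1
  norm_num at h1 h2
  linarith

open Filter Asymptotics in
/-- The error term is `(log₂ a n m - n m h) / h`, where `h` is the limit density; this is where
`h > 0` is needed. -/
theorem hasGrowthRate_of_eq {a : ℕ → ℕ → ℕ} {t k : Bool} (ha : ∀ n m, a n m = numSol t k n m) :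
    HasGrowthRate a (2 ^ limitDensity t k) := by
  have hpos := limitDensity_pos t k
  set h := limitDensity t k with hh
  have hbig : ∀ N : ℕ, ∀ᶠ p : ℕ × ℕ in atTop, N ≤ p.1 ∧ N ≤ p.2 := fun N => by
    filter_upwards [eventually_ge_atTop (N, N)] with p hp
    exact hp
  refine ⟨by positivity, fun p => (logSol t k p.1 p.2 - p.1 * p.2 * h) / h, ?_, ?_⟩
  · rw [isLittleO_iff]
    intro c hc
    obtain ⟨N, hN⟩ := exists_nat_gt (40 / (c * h))
    filter_upwards [hbig (N + 2)] with p hp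
    have n0 : (0 : ℝ) < p.1 := by exact_mod_cast (by omega : 0 < p.1)
    have m0 : (0 : ℝ) < p.2 := by exact_mod_cast (by omega : 0 < p.2)
    have h1 := abs_density_sub_limit_le t k (n := p.1) (m := p.2) (by omega) (by omega)
    have e : (logSol t k p.1 p.2 - p.1 * p.2 * h) / h =
        (p.1 * p.2) * ((density t k p.1 p.2 - h) / h) := by
      unfold density
      field_simp
    rw [e, norm_mul, mul_comm c]
    refine mul_le_mul_of_nonneg_left ?_ (norm_nonneg _)
    rw [Real.norm_eq_abs, abs_div, abs_of_pos hpos, div_le_iff₀ hpos]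
    refine h1.trans ?_
    have hc' : 0 < c * h := mul_pos hc hpos
    rw [div_lt_iff₀ hc'] at hN
    have key : ∀ q : ℕ, N + 2 ≤ q → 40 * (1 / (q : ℝ)) ≤ c * h := fun q hq => by
      have q0 : (0 : ℝ) < q := by exact_mod_cast (by omega : 0 < q)
      have q1 : (N : ℝ) ≤ q := by exact_mod_cast (by omega : N ≤ q)
      rw [mul_one_div, div_le_iff₀ q0]
      nlinarith
    have k1 := key p.1 hp.1
    have k2 := key p.2 hp.2
    linarith
  · filter_upwards [hbig 2] with p hp
    have h0 : (0 : ℝ) < numSol t k p.1 p.2 := by exact_mod_cast numSol_pos hp.1 p.2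
    rw [ha, ← Real.rpow_mul two_pos.le]
    have e : h * ((p.1 : ℝ) * p.2 + (logSol t k p.1 p.2 - p.1 * p.2 * h) / h) =
        logSol t k p.1 p.2 := by
      field_simp
      ring
    rw [e, logSol, Real.rpow_logb two_pos (by norm_num) h0]

/-! ### Solutions on the grid graph -/

/-- The embedding of the vertices of the grid graph in the lattice. -/
def gridEmb (n m : ℕ) : Fin n × Fin m ↪ ℕ × ℕ :=
  ⟨fun p => (p.1, p.2), fun p q h => by
    simp only [Prod.mk.injEq] at h
    exact Prod.ext (Fin.ext h.1) (Fin.ext h.2)⟩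

theorem grid_adj {n m : ℕ} (v w : Fin n × Fin m) :
    (grid n m).Adj v w ↔ LatAdj (gridEmb n m v) (gridEmb n m w) := by
  rw [grid, SimpleGraph.boxProd_adj, SimpleGraph.pathGraph_adj, SimpleGraph.pathGraph_adj]
  simp only [LatAdj, gridEmb, Fin.ext_iff]
  tauto

/-- Every vertex of the grid is dominated by an element of `S`. -/
def GridDom (t : Bool) (n m : ℕ) (S : Set (Fin n × Fin m)) : Prop :=
  ∀ v, ∃ w ∈ S, Dominates t (gridEmb n m v) (gridEmb n m w)

theorem isDominating_iff {n m : ℕ} (S : Set (Fin n × Fin m)) :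
    IsDominating (grid n m) S ↔ GridDom false n m S := by
  refine forall_congr' fun v => ?_
  simp only [Dominates, grid_adj, (gridEmb n m).injective.eq_iff, true_and]
  constructor
  · rintro (h | ⟨w, hw, h⟩)
    · exact ⟨v, h, Or.inl rfl⟩
    · exact ⟨w, hw, Or.inr h⟩
  · rintro ⟨w, hw, rfl | h⟩
    · exact Or.inl hw
    · exact Or.inr ⟨w, hw, h⟩

theorem isTotalDominating_iff {n m : ℕ} (S : Set (Fin n × Fin m)) :
    IsTotalDominating (grid n m) S ↔ GridDom true n m S := by
  simp [IsTotalDominating, GridDom, Dominates, grid_adj]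

/-- A dominating set is minimal if and only if each of its elements has a private neighbour. -/
theorem minimal_gridDom_iff {t : Bool} {n m : ℕ} {S : Set (Fin n × Fin m)} :
    Minimal (GridDom t n m) S ↔ GridDom t n m S ∧ ∀ v ∈ S, ∃ p,
      Dominates t (gridEmb n m p) (gridEmb n m v) ∧
        ∀ w ∈ S, Dominates t (gridEmb n m p) (gridEmb n m w) → w = v := by
  constructor
  · refine fun h => ⟨h.prop, fun v hv => ?_⟩
    have h1 : ¬GridDom t n m (S \ {v}) := fun h' => (h.le_of_le h' Set.sdiff_subset hv).2 rfl
    unfold GridDom at h1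
    push Not at h1
    obtain ⟨p, hp⟩ := h1
    have h3 : ∀ w ∈ S, Dominates t (gridEmb n m p) (gridEmb n m w) → w = v := fun w hw hpw => by
      by_contra hne
      exact hp w ⟨hw, hne⟩ hpw
    obtain ⟨q, hq, hpq⟩ := h.prop p
    exact ⟨p, h3 q hq hpq ▸ hpq, h3⟩
  · rintro ⟨h, h'⟩
    refine ⟨h, fun T hT hTS v hv => ?_⟩
    obtain ⟨p, -, hp⟩ := h' v hv
    obtain ⟨w, hw, hpw⟩ := hT p
    exact hp w (hTS hw) hpw ▸ hw

theorem ncard_gridDom (t k : Bool) (n m : ℕ) :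
    {S : Set (Fin n × Fin m) | GridDom t n m S ∧ (k = true → ∀ v ∈ S, ∃ p,
      Dominates t (gridEmb n m p) (gridEmb n m v) ∧
        ∀ w ∈ S, Dominates t (gridEmb n m p) (gridEmb n m w) → w = v)}.ncard =
      numSol t k n m := by
  classical
  set Φ : Set (Fin n × Fin m) → Finset (ℕ × ℕ) := fun S => S.toFinset.map (gridEmb n m) with hΦ
  have hinj : Function.Injective Φ := fun S T h => by
    simpa [hΦ] using h
  have hmem : ∀ S v, v ∈ Φ S ↔ ∃ p ∈ S, gridEmb n m p = v := fun S v => by simp [hΦ]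
  have hstrip : ∀ v, v ∈ strip 0 n m ↔ ∃ p, gridEmb n m p = v := fun v => by
    rw [mem_strip]
    constructor
    · intro h
      exact ⟨(⟨v.1, h.1.2⟩, ⟨v.2, h.2⟩), rfl⟩
    · rintro ⟨p, rfl⟩
      exact ⟨⟨Nat.zero_le _, p.1.2⟩, p.2.2⟩
  have hsol : ∀ S, Sol t k (strip 0 n m) (Φ S) ↔ GridDom t n m S ∧ (k = true → ∀ v ∈ S, ∃ p,
      Dominates t (gridEmb n m p) (gridEmb n m v) ∧
        ∀ w ∈ S, Dominates t (gridEmb n m p) (gridEmb n m w) → w = v) := by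
    intro S
    have hsub : Φ S ⊆ strip 0 n m := fun v hv => by
      obtain ⟨p, -, rfl⟩ := (hmem S v).1 hv
      exact (hstrip _).2 ⟨p, rfl⟩
    simp only [Sol, hsub, true_and, Dom, HasPrivate, GridDom, hmem, hstrip, forall_exists_index,
      and_imp, forall_apply_eq_imp_iff₂, forall_apply_eq_imp_iff, exists_exists_and_eq_and,
      exists_exists_eq_and, (gridEmb n m).injective.eq_iff]
  rw [← Set.ncard_image_of_injective _ hinj, numSol, ← Set.ncard_coe_finset]
  congr 1
  ext T
  simp only [Set.mem_image, Set.mem_ofPred_eq, Finset.mem_coe, mem_sols, ← hsol]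
  constructor
  · rintro ⟨S, hS, rfl⟩
    exact hS
  · intro hT
    have : T = Φ {p | gridEmb n m p ∈ T} := by
      ext v
      rw [hmem]
      constructor
      · intro hv
        obtain ⟨p, rfl⟩ := (hstrip v).1 (hT.1 hv)
        exact ⟨p, hv, rfl⟩
      · rintro ⟨p, hp, rfl⟩
        exact hp
    exact ⟨_, this ▸ hT, this.symm⟩

theorem numD_eq (n m : ℕ) : numD n m = numSol false false n m := by
  rw [← ncard_gridDom, numD]
  simp [isDominating_iff]

theorem numT_eq (n m : ℕ) : numT n m = numSol true false n m := by
  rw [← ncard_gridDom, numT]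
  simp [isTotalDominating_iff]

theorem numM_eq (n m : ℕ) : numM n m = numSol false true n m := by
  rw [← ncard_gridDom, numM]
  have : IsDominating (grid n m) = GridDom false n m := funext fun S => propext (isDominating_iff S)
  simp only [this, minimal_gridDom_iff, true_imp_iff]

theorem numMT_eq (n m : ℕ) : numMT n m = numSol true true n m := by
  rw [← ncard_gridDom, numMT]
  have : IsTotalDominating (grid n m) = GridDom true n m :=
    funext fun S => propext (isTotalDominating_iff S)
  simp only [this, minimal_gridDom_iff, true_imp_iff]

/-! ### Coding of subsets of the grid by numbers -/

/-- The cell `(i, j)` of the `N × N` grid belongs to the set with code `s`: the cells are the bits of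
`s`, row after row. -/
def CodeMem (s N i j : ℕ) : Prop := s.testBit (i * N + j) = true

/-- `s` is the code of a solution on the `N × N` grid. -/
def CodeSol (t k : Bool) (s N : ℕ) : Prop :=
  (∀ i < N, ∀ j < N, ∃ i' < N, ∃ j' < N, CodeMem s N i' j' ∧ Dominates t (i, j) (i', j')) ∧
    (k = true → ∀ i < N, ∀ j < N, CodeMem s N i j → ∃ a < N, ∃ b < N,
      Dominates t (a, b) (i, j) ∧ ∀ c < N, ∀ d < N, CodeMem s N c d →
        Dominates t (a, b) (c, d) → c = i ∧ d = j)

/-- The numbers below `2 ^ (N * N)` code the subsets of the `N × N` grid bijectively. -/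
theorem countBelow_codeSol (t k : Bool) (N : ℕ) :
    countBelow (2 ^ (N * N)) (fun s => CodeSol t k s N) = numSol t k N N := by
  classical
  set Ψ : ℕ → Finset (ℕ × ℕ) := fun s => (strip 0 N N).filter (fun v => CodeMem s N v.1 v.2)
    with hΨ
  have hmem : ∀ s v, v ∈ Ψ s ↔ (v.1 < N ∧ v.2 < N) ∧ CodeMem s N v.1 v.2 := fun s v => by
    rw [hΨ, Finset.mem_filter, mem_strip]
    simp
  have hsol : ∀ s, Sol t k (strip 0 N N) (Ψ s) ↔ CodeSol t k s N := by
    intro s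
    have hsub : Ψ s ⊆ strip 0 N N := Finset.filter_subset _ _
    simp only [Sol, hsub, true_and, Dom, HasPrivate, hmem, mem_strip, Prod.forall, Prod.exists,
      CodeSol, Nat.zero_le, and_imp, Prod.mk.injEq]
    refine and_congr ?_ (imp_congr_right fun _ => ?_)
    · constructor
      · intro h i hi j hj
        obtain ⟨a, b, ⟨⟨ha, hb⟩, h1⟩, h2⟩ := h i j hi hj
        exact ⟨a, ha, b, hb, h1, h2⟩
      · intro h i j hi hj
        obtain ⟨a, ha, b, hb, h1, h2⟩ := h i hi j hj
        exact ⟨a, b, ⟨⟨ha, hb⟩, h1⟩, h2⟩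
    · constructor
      · intro h i hi j hj hc
        obtain ⟨a, b, ⟨ha, hb⟩, h1, h2⟩ := h i j hi hj hc
        exact ⟨a, ha, b, hb, h1, fun c hc d hd => h2 c d hc hd⟩
      · intro h i j hi hj hc
        obtain ⟨a, ha, b, hb, h1, h2⟩ := h i hi j hj hc
        exact ⟨a, b, ⟨ha, hb⟩, h1, fun c d hc hd => h2 c hc d hd⟩
  refine Finset.card_bij (fun s _ => Ψ s) (fun s hs => ?_) (fun s hs s' hs' e => ?_)
    (fun S hS => ?_)
  · exact mem_sols.2 ((hsol s).2 (Finset.mem_filter.1 hs).2)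
  · have h1 := Finset.mem_range.1 (Finset.mem_filter.1 hs).1
    have h2 := Finset.mem_range.1 (Finset.mem_filter.1 hs').1
    refine Nat.eq_of_testBit_eq fun q => ?_
    by_cases hq : q < N * N
    · have hN : 0 < N := Nat.pos_of_ne_zero (by rintro rfl; simp at hq)
      have e1 := hmem s (q / N, q % N)
      have e2 := hmem s' (q / N, q % N)
      have e' : Ψ s = Ψ s' := e
      rw [e', e2] at e1
      have hlt : q / N < N ∧ q % N < N := ⟨Nat.div_lt_of_lt_mul hq, Nat.mod_lt _ hN⟩
      simp only [hlt, true_and, CodeMem, and_self] at e1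
      rw [mul_comm (q / N) N, Nat.div_add_mod] at e1
      exact (Bool.eq_iff_iff.2 e1).symm
    · have hle : 2 ^ (N * N) ≤ 2 ^ q := Nat.pow_le_pow_right two_pos (by omega)
      rw [Nat.testBit_lt_two_pow (h1.trans_le hle), Nat.testBit_lt_two_pow (h2.trans_le hle)]
  · have hS' := mem_sols.1 hS
    set s := Nat.ofBits (fun q : Fin (N * N) => decide (((q : ℕ) / N, (q : ℕ) % N) ∈ S)) with hs
    have hΨs : Ψ s = S := by
      ext ⟨i, j⟩
      rw [hmem]
      have key : i < N → j < N → (CodeMem s N i j ↔ (i, j) ∈ S) := fun hi hj => by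
        have hlt : i * N + j < N * N := by nlinarith
        have hN : 0 < N := by omega
        rw [CodeMem, hs, Nat.testBit_ofBits_lt _ _ hlt]
        dsimp only
        rw [decide_eq_true_iff, mul_comm i N, Nat.mul_add_div hN, Nat.mul_add_mod,
          Nat.div_eq_of_lt hj, Nat.mod_eq_of_lt hj, add_zero]
      constructor
      · rintro ⟨⟨hi, hj⟩, h⟩
        exact (key hi hj).1 h
      · intro h
        have := mem_strip.1 (hS'.1 h)
        dsimp only at this
        exact ⟨by dsimp only; omega, (key this.1.2 this.2).2 h⟩
    exact ⟨s, Finset.mem_filter.2 ⟨Finset.mem_range.2 (Nat.ofBits_lt_two_pow _),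
      (hsol s).1 (hΨs.symm ▸ hS')⟩, hΨs⟩

/-! ### Recognition of solutions in polynomial time -/

section Feasible

variable {α : Type} [Ctx α]

theorem FeasP.dominates (t : Bool) {a b c d : α → ℕ} (ha : Feas a) (hb : Feas b) (hc : Feas c)
    (hd : Feas d) : FeasP (fun x => Dominates t (a x, b x) (c x, d x)) := by
  refine (((FeasP.const (t = false)).and ((FeasP.eq ha hc).and (FeasP.eq hb hd))).or
    (((FeasP.eq ha hc).and ((FeasP.eq hb.succ hd).or (FeasP.eq hd.succ hb))).or
      ((FeasP.eq hb hd).and ((FeasP.eq ha.succ hc).or (FeasP.eq hc.succ ha))))).congr fun x => ?_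
  simp only [Dominates, LatAdj, Prod.mk.injEq]

theorem FeasP.codeMem {s N i j : α → ℕ} (hs : Feas s) (hN : Feas N) (hi : Feas i) (hj : Feas j) :
    FeasP (fun x => CodeMem (s x) (N x) (i x) (j x)) :=
  FeasP.testBit hs ((hi.mul hN).add hj)

theorem FeasP.codeSol (t k : Bool) {s N : α → ℕ} (hs : Feas s) (hN : Feas N) :
    FeasP (fun x => CodeSol t k (s x) (N x)) := by
  refine FeasP.and ?_ (FeasP.imp (FeasP.const _) ?_)
  · refine FeasP.ball (p := fun x : ℕ × α => ∀ j < N x.2, ∃ i' < N x.2, ∃ j' < N x.2,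
      CodeMem (s x.2) (N x.2) i' j' ∧ Dominates t (x.1, j) (i', j')) hN ?_
    refine FeasP.ball (p := fun x : ℕ × ℕ × α => ∃ i' < N x.2.2, ∃ j' < N x.2.2,
      CodeMem (s x.2.2) (N x.2.2) i' j' ∧ Dominates t (x.2.1, x.1) (i', j')) hN.snd ?_
    refine FeasP.bex (p := fun x : ℕ × ℕ × ℕ × α => ∃ j' < N x.2.2.2,
      CodeMem (s x.2.2.2) (N x.2.2.2) x.1 j' ∧ Dominates t (x.2.2.1, x.2.1) (x.1, j'))
      hN.snd.snd ?_
    refine FeasP.bex (p := fun x : ℕ × ℕ × ℕ × ℕ × α =>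
      CodeMem (s x.2.2.2.2) (N x.2.2.2.2) x.2.1 x.1 ∧
        Dominates t (x.2.2.2.1, x.2.2.1) (x.2.1, x.1)) hN.snd.snd.snd ?_
    exact (FeasP.codeMem hs.snd.snd.snd.snd hN.snd.snd.snd.snd Feas.fst.snd Feas.fst).and
      (FeasP.dominates t Feas.fst.snd.snd.snd Feas.fst.snd.snd Feas.fst.snd Feas.fst)
  · refine FeasP.ball (p := fun x : ℕ × α => ∀ j < N x.2, CodeMem (s x.2) (N x.2) x.1 j →
      ∃ a < N x.2, ∃ b < N x.2, Dominates t (a, b) (x.1, j) ∧ ∀ c < N x.2, ∀ d < N x.2,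
        CodeMem (s x.2) (N x.2) c d → Dominates t (a, b) (c, d) → c = x.1 ∧ d = j) hN ?_
    refine FeasP.ball (p := fun x : ℕ × ℕ × α => CodeMem (s x.2.2) (N x.2.2) x.2.1 x.1 →
      ∃ a < N x.2.2, ∃ b < N x.2.2, Dominates t (a, b) (x.2.1, x.1) ∧
        ∀ c < N x.2.2, ∀ d < N x.2.2, CodeMem (s x.2.2) (N x.2.2) c d →
          Dominates t (a, b) (c, d) → c = x.2.1 ∧ d = x.1) hN.snd ?_
    refine FeasP.imp (FeasP.codeMem hs.snd.snd hN.snd.snd Feas.fst.snd Feas.fst) ?_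
    refine FeasP.bex (p := fun x : ℕ × ℕ × ℕ × α => ∃ b < N x.2.2.2,
      Dominates t (x.1, b) (x.2.2.1, x.2.1) ∧
        ∀ c < N x.2.2.2, ∀ d < N x.2.2.2, CodeMem (s x.2.2.2) (N x.2.2.2) c d →
          Dominates t (x.1, b) (c, d) → c = x.2.2.1 ∧ d = x.2.1) hN.snd.snd ?_
    refine FeasP.bex (p := fun x : ℕ × ℕ × ℕ × ℕ × α =>
      Dominates t (x.2.1, x.1) (x.2.2.2.1, x.2.2.1) ∧
        ∀ c < N x.2.2.2.2, ∀ d < N x.2.2.2.2, CodeMem (s x.2.2.2.2) (N x.2.2.2.2) c d →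
          Dominates t (x.2.1, x.1) (c, d) → c = x.2.2.2.1 ∧ d = x.2.2.1) hN.snd.snd.snd ?_
    refine (FeasP.dominates t Feas.fst.snd Feas.fst Feas.fst.snd.snd.snd Feas.fst.snd.snd).and ?_
    refine FeasP.ball (p := fun x : ℕ × ℕ × ℕ × ℕ × ℕ × α =>
      ∀ d < N x.2.2.2.2.2, CodeMem (s x.2.2.2.2.2) (N x.2.2.2.2.2) x.1 d →
        Dominates t (x.2.2.1, x.2.1) (x.1, d) → x.1 = x.2.2.2.2.1 ∧ d = x.2.2.2.1)
      hN.snd.snd.snd.snd ?_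
    refine FeasP.ball (p := fun x : ℕ × ℕ × ℕ × ℕ × ℕ × ℕ × α =>
      CodeMem (s x.2.2.2.2.2.2) (N x.2.2.2.2.2.2) x.2.1 x.1 →
        Dominates t (x.2.2.2.1, x.2.2.1) (x.2.1, x.1) →
          x.2.1 = x.2.2.2.2.2.1 ∧ x.1 = x.2.2.2.2.1) hN.snd.snd.snd.snd.snd ?_
    exact (FeasP.codeMem hs.snd.snd.snd.snd.snd.snd hN.snd.snd.snd.snd.snd.snd
      Feas.fst.snd Feas.fst).imp ((FeasP.dominates t Feas.fst.snd.snd.snd Feas.fst.snd.snd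
        Feas.fst.snd Feas.fst).imp
      ((FeasP.eq Feas.fst.snd Feas.fst.snd.snd.snd.snd.snd).and
        (FeasP.eq Feas.fst Feas.fst.snd.snd.snd.snd)))

end Feasible

/-! ### The approximation of the growth rate -/

/-- The integral part of the logarithm of the number of solutions on the `N × N` grid, divided by
`N`. -/
noncomputable def approxExp (t k : Bool) (N : ℕ) : ℕ := Nat.log 2 (numSol t k N N) / N

/-- The integral part of `N * 2 ^ (l / N)`, where `l = approxExp t k N`. As `l ≤ N`, it is at most
`2 * N`. -/
noncomputable def approxNum (t k : Bool) (N : ℕ) : ℕ :=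
  Nat.findGreatest (fun b => b ^ N ≤ 2 ^ approxExp t k N * N ^ N) (2 * N)

theorem approxExp_le (t k : Bool) (N : ℕ) : approxExp t k N ≤ N := by
  rcases Nat.eq_zero_or_pos N with rfl | hN
  · simp [approxExp]
  · refine Nat.div_le_of_le_mul ?_
    refine (Nat.log_mono_right (numSol_le t k N N)).trans ?_
    rw [Nat.log_pow one_lt_two]

theorem approxNum_pow_le (t k : Bool) {N : ℕ} (hN : N ≠ 0) :
    approxNum t k N ^ N ≤ 2 ^ approxExp t k N * N ^ N :=
  Nat.findGreatest_spec (P := fun b => b ^ N ≤ 2 ^ approxExp t k N * N ^ N) (m := 0)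
    (Nat.zero_le _) (by simp [hN])

theorem pow_le_iff_le_approxNum (t k : Bool) {N b : ℕ} (hN : N ≠ 0) (hb : b ≤ 2 * N) :
    b ^ N ≤ 2 ^ approxExp t k N * N ^ N ↔ b ≤ approxNum t k N :=
  ⟨fun h => Nat.le_findGreatest hb h,
    fun h => (Nat.pow_le_pow_left h N).trans (approxNum_pow_le t k hN)⟩

/-- The numerator of the approximation is computed in time polynomial in `2 ^ (N * N)`: all codes
are tried, and the integral parts in the definitions of `approxExp` and `approxNum` are found by
counting. -/
theorem exists_feas_approxNum (t k : Bool) : ∃ F : ℕ × ℕ → ℕ, Feas F ∧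
    ∀ N, 2 ≤ N → F (2 ^ (N * N), N) = approxNum t k N := by
  set cnt : ℕ × ℕ → ℕ := fun p => countBelow p.1 fun s => CodeSol t k s p.2
    with hcnt
  have fcnt : Feas cnt := Feas.count (p := fun q : ℕ × ℕ × ℕ => CodeSol t k q.1 q.2.2) Feas.fst
    (FeasP.codeSol t k Feas.fst Feas.id.snd.snd)
  set l : ℕ × ℕ → ℕ := fun p => countBelow p.2 fun j =>
    ¬cnt p / 2 ^ ((j + 1) * p.2) = 0 with hl
  have fl : Feas l := Feas.count (p := fun q : ℕ × ℕ × ℕ =>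
      ¬cnt q.2 / 2 ^ ((q.1 + 1) * q.2.2) = 0) Feas.id.snd
    (FeasP.eq_zero (Feas.divPow fcnt.snd (Feas.fst.succ.mul Feas.id.snd.snd))).not
  have fB : Feas (fun p : ℕ × ℕ => p.1 * p.1 + 1) := (Feas.fst.mul Feas.fst).succ
  -- With `p = (X, N)` and `X = 2 ^ (N * N)`, the right-hand side `2 ^ l * N ^ N` is at most `X * X`,
  -- so that truncation of the powers at `X * X + 1` does not affect the comparison. The basis
  -- `N - 1 + 1` equals `N` and is visibly positive.
  set b : ℕ × ℕ → ℕ := fun p => countBelow (2 * p.2) fun j =>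
    min ((j + 1) ^ p.2) (p.1 * p.1 + 1) ≤
      min (2 ^ l p) (p.1 * p.1 + 1) * min ((p.2 - 1 + 1) ^ p.2) (p.1 * p.1 + 1) with hb
  have fb : Feas b := Feas.count (p := fun q : ℕ × ℕ × ℕ =>
      min ((q.1 + 1) ^ q.2.2) (q.2.1 * q.2.1 + 1) ≤ min (2 ^ l q.2) (q.2.1 * q.2.1 + 1) *
        min ((q.2.2 - 1 + 1) ^ q.2.2) (q.2.1 * q.2.1 + 1))
    ((Feas.const 2).mul Feas.id.snd)
    (FeasP.le (Feas.minPow Feas.fst.succ Feas.id.snd.snd fB.snd fun _ => Nat.succ_pos _)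
      ((Feas.minPow (Feas.const 2) fl.snd fB.snd fun _ => one_le_two).mul
        (Feas.minPow Feas.id.snd.snd.pred.succ Feas.id.snd.snd fB.snd fun _ => Nat.succ_pos _)))
  refine ⟨b, fb, fun N hN => ?_⟩
  have hN0 : N ≠ 0 := by omega
  have e1 : cnt (2 ^ (N * N), N) = numSol t k N N := countBelow_codeSol t k N
  have e2 : l (2 ^ (N * N), N) = approxExp t k N := by
    simp only [hl, e1]
    refine countBelow_eq (fun j _ => ?_) (approxExp_le t k N)
    have h0 := (numSol_pos (t := t) (k := k) hN N).ne'
    rw [← ne_eq, ← Nat.pos_iff_ne_zero, Nat.div_pos_iff, and_iff_right (by positivity),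
      ← Nat.le_log_iff_pow_le one_lt_two h0, approxExp, ← Nat.succ_le_iff, Nat.succ_eq_add_one,
      Nat.le_div_iff_mul_le (by omega)]
  have h2N : N < 2 ^ N := Nat.lt_two_pow_self
  have h3 : 2 ^ approxExp t k N ≤ 2 ^ (N * N) :=
    Nat.pow_le_pow_right two_pos ((approxExp_le t k N).trans (Nat.le_mul_self N))
  have h4 : N ^ N ≤ 2 ^ (N * N) := by
    rw [pow_mul]
    exact Nat.pow_le_pow_left h2N.le N
  have h5 := Nat.mul_le_mul h3 h4
  have h6 : 0 < 2 ^ (N * N) := by positivity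
  have h7 : 2 ^ (N * N) ≤ 2 ^ (N * N) * 2 ^ (N * N) := Nat.le_mul_self _
  simp only [hb, e2, Nat.sub_add_cancel (by omega : 1 ≤ N)]
  rw [min_eq_left (h3.trans (by omega)), min_eq_left (h4.trans (by omega))]
  refine countBelow_eq (fun j hj => ?_) (Nat.findGreatest_le _)
  rw [min_le_iff, or_iff_left (by omega), pow_le_iff_le_approxNum t k hN0 (by omega)]
  omega

/-- The function `2 ^ x` is Lipschitz with constant `2` on `(-∞, 1]`. -/
theorem abs_rpow_two_sub_le {x y : ℝ} (hx : x ≤ 1) (hy : y ≤ 1) :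
    |(2 : ℝ) ^ x - 2 ^ y| ≤ 2 * |x - y| := by
  wlog h : y ≤ x generalizing x y
  · rw [abs_sub_comm, abs_sub_comm x]
    exact this hy hx (le_of_not_ge h)
  have h1 : (2 : ℝ) ^ y = 2 ^ x * Real.exp (Real.log 2 * (y - x)) := by
    rw [← Real.rpow_def_of_pos two_pos, ← Real.rpow_add two_pos]
    congr 1
    ring
  have h2 := Real.add_one_le_exp (Real.log 2 * (y - x))
  have h3 : (2 : ℝ) ^ x ≤ 2 := by
    simpa using Real.rpow_le_rpow_of_exponent_le one_le_two hx
  have h4 : (0 : ℝ) < 2 ^ x := by positivity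
  have h5 : Real.log 2 ≤ 1 := by
    have := Real.log_two_lt_d9
    linarith
  have h6 : Real.exp (Real.log 2 * (y - x)) ≤ 1 := by
    rw [Real.exp_le_one_iff]
    exact mul_nonpos_of_nonneg_of_nonpos (Real.log_nonneg one_le_two) (by linarith)
  rw [h1, show (2 : ℝ) ^ x - 2 ^ x * Real.exp (Real.log 2 * (y - x)) =
    2 ^ x * (1 - Real.exp (Real.log 2 * (y - x))) by ring, abs_mul, abs_of_pos h4,
    abs_of_nonneg (by linarith : (0 : ℝ) ≤ 1 - _), abs_of_nonneg (by linarith : 0 ≤ x - y)]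
  refine mul_le_mul h3 ?_ (by linarith) two_pos.le
  nlinarith

theorem abs_approxNum_div_sub_le (t k : Bool) {N : ℕ} (hN : N ≠ 0) :
    |(approxNum t k N : ℝ) / N - 2 ^ ((approxExp t k N : ℝ) / N)| ≤ 1 / N := by
  have N0 : (0 : ℝ) < N := by exact_mod_cast Nat.pos_of_ne_zero hN
  set l := approxExp t k N with hl
  set b := approxNum t k N with hb
  set y : ℝ := 2 ^ ((l : ℝ) / N) * N with hy
  have y0 : 0 < y := by positivity
  have hyN : y ^ N = 2 ^ l * (N : ℝ) ^ N := by
    rw [hy, mul_pow, ← Real.rpow_mul_natCast two_pos.le, div_mul_cancel₀ _ N0.ne',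
      Real.rpow_natCast]
  have h1 : (b : ℝ) ≤ y := by
    refine le_of_pow_le_pow_left₀ hN y0.le ?_
    rw [hyN]
    exact_mod_cast approxNum_pow_le t k hN
  have h2 : y ≤ b + 1 := by
    by_cases h : b + 1 ≤ 2 * N
    · refine le_of_pow_le_pow_left₀ hN (by positivity) ?_
      rw [hyN]
      have h3 := (pow_le_iff_le_approxNum t k hN h).not.2 (by omega)
      exact_mod_cast (not_le.1 h3).le
    · have h3 : (2 * N : ℝ) ≤ b + 1 := by exact_mod_cast (by omega : 2 * N ≤ b + 1)
      refine le_trans ?_ h3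
      refine mul_le_mul_of_nonneg_right ?_ N0.le
      have h4 : (l : ℝ) / N ≤ 1 := by
        rw [div_le_one N0]
        exact_mod_cast approxExp_le t k N
      simpa using Real.rpow_le_rpow_of_exponent_le one_le_two h4
  have e : (b : ℝ) / N - 2 ^ ((l : ℝ) / N) = (b - y) / N := by
    rw [hy]
    field_simp
  rw [e, abs_div, abs_of_pos N0]
  refine div_le_div_of_nonneg_right ?_ N0.le
  rw [abs_le]
  constructor <;> linarith

theorem abs_approxExp_div_sub_density_le (t k : Bool) {N : ℕ} (hN : 2 ≤ N) :
    |(approxExp t k N : ℝ) / N - density t k N N| ≤ 1 / N := by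
  have N0 : (0 : ℝ) < N := by exact_mod_cast (by omega : 0 < N)
  have h0 := numSol_pos (t := t) (k := k) hN N
  set l := approxExp t k N with hl
  have a1 : 2 ^ (l * N) ≤ numSol t k N N :=
    (Nat.pow_le_pow_right two_pos (Nat.div_mul_le_self _ _)).trans (Nat.pow_log_le_self 2 h0.ne')
  have a2 : numSol t k N N ≤ 2 ^ ((l + 1) * N) := by
    refine (Nat.lt_pow_succ_log_self one_lt_two _).le.trans (Nat.pow_le_pow_right two_pos ?_)
    have := Nat.lt_div_mul_add (a := Nat.log 2 (numSol t k N N)) (b := N) (by omega)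
    rw [Nat.succ_mul]
    exact this
  have a1' : (2 : ℝ) ^ (l * N) ≤ numSol t k N N := by exact_mod_cast a1
  have a2' : (numSol t k N N : ℝ) ≤ 2 ^ ((l + 1) * N) := by exact_mod_cast a2
  have b1 := Real.logb_le_logb_of_le one_lt_two (by positivity) a1'
  have b2 := Real.logb_le_logb_of_le one_lt_two (by exact_mod_cast h0) a2'
  rw [Real.logb_pow, Real.logb_self_eq_one one_lt_two, mul_one] at b1 b2
  push_cast at b1 b2
  have e : (l : ℝ) / N - density t k N N = (l * N - logSol t k N N) / (N * N) := by
    unfold density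
    field_simp
  rw [e, abs_div, abs_of_pos (mul_pos N0 N0), div_le_div_iff₀ (mul_pos N0 N0) N0]
  have : |(l : ℝ) * N - logSol t k N N| ≤ N := by
    rw [abs_le]
    unfold logSol
    constructor <;> linarith
  nlinarith

/-- The approximation on the grid of side `N = 100 n` has precision `1 / n`: its error is at most
`1 / N` from the rounding in `approxNum`, plus twice the error `1 / N + 40 / N` on the exponent. -/
theorem abs_sub_approxNum_div_le (t k : Bool) {n : ℕ} (hn : 1 ≤ n) :
    |(2 : ℝ) ^ limitDensity t k - (approxNum t k (100 * n) : ℝ) / (100 * n : ℕ)| ≤ 1 / n := by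
  have n0 : (0 : ℝ) < n := by exact_mod_cast hn
  set N := 100 * n with hN
  have N0 : (0 : ℝ) < N := by exact_mod_cast (by omega : 0 < N)
  have eN : (N : ℝ) = 100 * n := by
    rw [hN]
    push_cast
    ring
  have h1 := abs_approxNum_div_sub_le t k (N := N) (by omega)
  have h2 := abs_approxExp_div_sub_density_le t k (N := N) (by omega)
  have h3 := abs_density_sub_limit_le t k (n := N) (m := N) (by omega) (by omega)
  have h4 : (approxExp t k N : ℝ) / N ≤ 1 := by
    rw [div_le_one N0]
    exact_mod_cast approxExp_le t k N
  have h5 := abs_rpow_two_sub_le h4 (limitDensity_le_one t k)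
  have h6 := abs_sub_le ((approxExp t k N : ℝ) / N) (density t k N N) (limitDensity t k)
  have h7 := abs_sub_le ((approxNum t k N : ℝ) / N) (2 ^ ((approxExp t k N : ℝ) / N))
    (2 ^ limitDensity t k)
  have h8 : (1 : ℝ) / n = 100 * (1 / N) := by
    rw [eN]
    field_simp
  have h9 : (0 : ℝ) < 1 / N := by positivity
  rw [abs_sub_comm, h8]
  linarith

/-! ### Binary input and output -/

open Computability in
theorem encodePosNum_eq_bits (p : PosNum) : encodePosNum p = (p : ℕ).bits := by
  induction p with
  | one => simp [encodePosNum]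
  | bit0 p ih =>
    rw [encodePosNum, ih, PosNum.cast_bit0, ← two_mul, Nat.bit0_bits _ (PosNum.to_nat_pos p).ne']
  | bit1 p ih =>
    rw [encodePosNum, ih, PosNum.cast_bit1, ← two_mul, Nat.bit1_bits]

open Computability in
theorem encodeNat_eq_bits (n : ℕ) : encodeNat n = n.bits := by
  have h : ∀ a : Num, encodeNum a = (a : ℕ).bits := by
    rintro (_ | p)
    · simp [encodeNum]
    · exact encodePosNum_eq_bits p
  rw [encodeNat, h, Num.to_of_nat]

/-- The store with empty registers. -/
def Store.empty (o : List (Option Bool)) : Store := ⟨fun _ => [], o⟩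

@[simp] theorem Store.reg_empty (o : List (Option Bool)) (r : ℕ) : (Store.empty o).reg r = [] := rfl

namespace Prog

/-- Double the content of the unary register `r`, by means of the empty register `t`. -/
def double (r t : ℕ) : Prog := seq (loop r (seq (push t true) (push t true)) skip) (move t r)

theorem double_runs {r t : ℕ} (hrt : r ≠ t) (s : Store) {n : ℕ} (h : s.reg r = un n)
    (ht : s.reg t = []) : Runs (double r t) s (7 * n + 2) (s.set r (un (2 * n))) := by
  have h1 := Runs.for_loop (r := r) (p := seq (push t true) (push t true)) (q := skip) n
    (fun i => s.set t (un (2 * i))) (fun _ => 2) (fun i _ => by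
      refine ((Runs.push _ _ _).seq (Runs.push _ _ _)).congr le_rfl ?_
      rw [show 2 * (i + 1) = 2 * i + 1 + 1 by ring]
      ext1
      · funext x
        simp only [Store.reg_set]
        split_ifs <;> simp_all [List.replicate_succ]
      · rfl)
  beta_reduce at h1
  rw [s.set_eq_self (r := t) (l := un (2 * 0)) ht, s.set_eq_self h] at h1
  refine (h1.seq (move_runs (n := 2 * n) (m := 0) hrt.symm _ ?_ ?_)).congr (by simp; omega) ?_
  · simp [Store.reg_set, hrt.symm]
  · simp
  · ext1
    · funext x
      simp only [Store.reg_set]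
      split_ifs <;> simp_all
    · rfl

/-- Double the content of the unary register `r` and add its old content to the unary register `d`,
by means of the empty register `t`. -/
def doubleAdd (r d t : ℕ) : Prog :=
  seq (loop r (seq (push d true) (seq (push t true) (push t true))) skip) (move t r)

theorem doubleAdd_runs {r d t : ℕ} (hrd : r ≠ d) (hrt : r ≠ t) (hdt : d ≠ t) (s : Store) {n m : ℕ}
    (h : s.reg r = un n) (hd : s.reg d = un m) (ht : s.reg t = []) :
    Runs (doubleAdd r d t) s (8 * n + 2) ((s.set r (un (2 * n))).set d (un (m + n))) := by
  have h1 := Runs.for_loop (r := r) (p := seq (push d true) (seq (push t true) (push t true)))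
    (q := skip) n (fun i => (s.set d (un (m + i))).set t (un (2 * i))) (fun _ => 3) (fun i _ => by
      refine ((Runs.push _ _ _).seq ((Runs.push _ _ _).seq (Runs.push _ _ _))).congr le_rfl ?_
      rw [show 2 * (i + 1) = 2 * i + 1 + 1 by ring, show m + (i + 1) = m + i + 1 by ring]
      ext1
      · funext x
        simp only [Store.reg_set]
        split_ifs <;> simp_all [List.replicate_succ]
      · rfl)
  beta_reduce at h1
  rw [s.set_eq_self (r := d) (l := un (m + 0)) hd, s.set_eq_self (r := t) (l := un (2 * 0)) ht,
    s.set_eq_self h] at h1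
  refine (h1.seq (move_runs (n := 2 * n) (m := 0) hrt.symm _ ?_ ?_)).congr (by simp; omega) ?_
  · simp [Store.reg_set, hrt.symm]
  · simp
  · ext1
    · funext x
      simp only [Store.reg_set]
      split_ifs <;> simp_all
    · rfl

/-- Convert the binary number in register `0`, least significant bit first, to a unary number in
register `2`: the weight of the current bit is kept in register `1`. -/
def readBinary : Prog :=
  seq (push 1 true) (seq (loop 0 (doubleAdd 1 2 3) (double 1 3)) (clear 1))

theorem readBinary_runs (n : ℕ) :
    Runs readBinary ((Store.empty []).set 0 n.bits) (20 * (n + 1) * 2 ^ n)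
      ((Store.empty []).set 2 (un n)) := by
  set L := n.bits.length with hL
  have hLn : L ≤ n := by
    rw [hL, Nat.size_eq_bits_len, Nat.size_le]
    exact Nat.lt_two_pow_self
  have h2L : 2 ^ L ≤ 2 ^ n := Nat.pow_le_pow_right two_pos hLn
  have h1 := Runs.word_loop (r := 0) (p := doubleAdd 1 2 3) (q := double 1 3) n.bits
    (fun l => ((Store.empty []).set 1 (un (2 ^ (L - l.length)))).set 2
      (un (n % 2 ^ (L - l.length)))) (8 * 2 ^ n + 2) (fun b l hl => by
      obtain ⟨pre, hpre⟩ := hl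
      set i := pre.length with hi
      have hlen : L = i + (l.length + 1) := by rw [hL, ← hpre]; simp [hi]
      have hb : n.testBit i = b := by
        have h0 : i < n.bits.length := by omega
        rw [Nat.testBit_eq_inth, List.getI_eq_getElem _ h0]
        simp [← hpre, hi]
      have e1 : L - (b :: l).length = i := by rw [List.length_cons]; omega
      have e2 : L - l.length = i + 1 := by omega
      have hlt : 2 ^ i ≤ 2 ^ n := Nat.pow_le_pow_right two_pos (by omega)
      have hmod : n % 2 ^ (i + 1) = n % 2 ^ i + 2 ^ i * b.toNat := by
        rw [← hb, pow_succ, Nat.mod_mul, Nat.testBit_eq_decide_div_mod_eq]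
        rcases Nat.mod_two_eq_zero_or_one (n / 2 ^ i) with h | h <;> simp [h]
      rw [e1, e2, hmod, pow_succ, mul_comm (2 ^ i) 2]
      cases b with
      | true =>
        refine (doubleAdd_runs (r := 1) (d := 2) (t := 3) (n := 2 ^ i) (m := n % 2 ^ i)
          (by decide) (by decide) (by decide) _ (by simp [Store.reg_set])
          (by simp [Store.reg_set]) (by simp [Store.reg_set])).congr (by omega) ?_
        ext1
        · funext x
          simp only [Store.reg_set]
          split_ifs <;> simp_all
        · rfl
      | false =>
        refine (double_runs (r := 1) (t := 3) (n := 2 ^ i) (by decide) _ (by simp [Store.reg_set])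
          (by simp [Store.reg_set])).congr (by omega) ?_
        ext1
        · funext x
          simp only [Store.reg_set]
          split_ifs <;> simp_all
        · rfl)
  have e0 : n % 2 ^ L = n := Nat.mod_eq_of_lt (Nat.size_le.1 (Nat.size_eq_bits_len n).ge)
  simp only [← hL, Nat.sub_self, pow_zero, Nat.mod_one, List.length_nil, Nat.sub_zero, e0] at h1
  have h2 := clear_runs 1 ((((Store.empty []).set 1 (un (2 ^ L))).set 2 (un n)).set 0 [])
    (n := 2 ^ L) (by simp [Store.reg_set])
  have h0 := Runs.push 1 true ((Store.empty []).set 0 n.bits)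
  have e : ((Store.empty []).set 0 n.bits).set 1 (true :: ((Store.empty []).set 0 n.bits).reg 1) =
      (((Store.empty []).set 1 (un 1)).set 2 (un 0)).set 0 n.bits := by
    ext1
    · funext x
      simp only [Store.reg_set]
      split_ifs <;> simp_all
    · rfl
  rw [e] at h0
  refine (h0.seq (h1.seq h2)).congr ?_ ?_
  · have h3 : L * (8 * 2 ^ n + 2 + 1) ≤ n * (8 * 2 ^ n + 2 + 1) := Nat.mul_le_mul_right _ hLn
    have h4 : 1 ≤ 2 ^ n := Nat.one_le_two_pow
    have h5 : n * 1 ≤ n * 2 ^ n := Nat.mul_le_mul_left _ h4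
    nlinarith
  · ext1
    · funext x
      simp only [Store.reg_set]
      split_ifs <;> simp_all
    · rfl

/-- From the unary number `e` in the register `r`, compute `2 ^ e` in the register `r + 1`. -/
def twoPow (r : ℕ) : Prog := seq (push (r + 1) true) (loop r (double (r + 1) (r + 2)) skip)

theorem twoPow_runs (r : ℕ) (s : Store) {e : ℕ} (h : s.reg r = un e) (h1 : s.reg (r + 1) = [])
    (h2 : s.reg (r + 2) = []) :
    Runs (twoPow r) s (10 * (e + 1) * 2 ^ e) ((s.set r []).set (r + 1) (un (2 ^ e))) := by
  have k := Runs.for_loop (r := r) (p := double (r + 1) (r + 2)) (q := skip) e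
    (fun i => s.set (r + 1) (un (2 ^ i))) (fun _ => 7 * 2 ^ e + 2) (fun i hi => by
      have : 2 ^ i ≤ 2 ^ e := Nat.pow_le_pow_right two_pos hi.le
      refine (double_runs (n := 2 ^ i) (by omega) _ (by simp [Store.reg_set])
        (by simp [Store.reg_set, h2])).congr (by omega) ?_
      rw [pow_succ, mul_comm]
      ext1
      · funext x
        simp only [Store.reg_set]
        split_ifs <;> simp_all
      · rfl)
  have k0 := Runs.push (r + 1) true s
  have e0 : s.set (r + 1) (true :: s.reg (r + 1)) = (s.set (r + 1) (un (2 ^ 0))).set r (un e) := by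
    ext1
    · funext x
      simp only [Store.reg_set]
      split_ifs <;> simp_all
    · rfl
  rw [e0] at k0
  refine (k0.seq k).congr ?_ ?_
  · simp only [Finset.sum_const, Finset.card_range, smul_eq_mul]
    have h4 : 1 ≤ 2 ^ e := Nat.one_le_two_pow
    have h5 : e * 1 ≤ e * 2 ^ e := Nat.mul_le_mul_left _ h4
    nlinarith
  · exact Store.set_comm _ (by omega) _ _

/-- Emit `true` if the register `r` contains `1`, and `false` if the register `r'` does. -/
def emitBit (r r' : ℕ) : Prog :=
  seq (loop r (emit (some true)) skip) (loop r' (emit (some false)) skip)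

theorem emitBit_runs {r r' : ℕ} (hr : r ≠ r') (s : Store) (v : Bool)
    (h : s.reg r = un (ind (v = true))) (h' : s.reg r' = un (ind (¬v = true))) :
    Runs (emitBit r r') s 4
      (((⟨s.reg, some v :: s.out⟩ : Store).set r []).set r' []) := by
  cases v with
  | true =>
    have h0 : s.reg r = [true] := by simpa [ind] using h
    have h1 : s.reg r' = [] := by simpa [ind] using h'
    refine ⟨1 + 1 + 1 + 1, by norm_num, .seq (.loop_cons h0 (.emit (some true) _)
      (.loop_nil (s.reg_set_self r []))) ?_⟩
    have e : (((⟨s.reg, some true :: s.out⟩ : Store).set r []).set r' []) =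
        ⟨(s.set r []).reg, some true :: (s.set r []).out⟩ := by
      rw [Store.set_eq_self]
      · rfl
      · rw [Store.reg_set_of_ne _ _ hr.symm]
        exact h1
    rw [e]
    exact .loop_nil ((s.reg_set_of_ne [] hr.symm).trans h1)
  | false =>
    have h0 : s.reg r = [] := by simpa [ind] using h
    have h1 : s.reg r' = [true] := by simpa [ind] using h'
    refine ⟨1 + (1 + 1 + 1), by norm_num, .seq (.loop_nil h0) (.loop_cons h1
      (.emit (some false) _) ?_)⟩
    rw [Store.set_eq_self ⟨s.reg, some false :: s.out⟩ h0]
    exact .loop_nil (s.reg_set_self r' [])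

end Prog

theorem feas_bits_length : Feas (fun x : ℕ => x.bits.length) := by
  refine (Feas.count (p := fun q : ℕ × ℕ => ¬q.2 / 2 ^ q.1 = 0) Feas.id
    (FeasP.eq_zero (Feas.divPow Feas.id.snd Feas.fst)).not).congr fun x => ?_
  rw [Nat.size_eq_bits_len]
  refine (countBelow_eq (fun i _ => ?_) (Nat.size_le.2 Nat.lt_two_pow_self)).symm
  rw [Nat.lt_size, ← ne_eq, ← Nat.pos_iff_ne_zero, Nat.div_pos_iff, and_iff_right (by positivity)]

/-- There is a program which writes a unary number in binary on the output stack, in polynomial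
time. The output is a stack, so the bits are emitted from the most significant one to the least
significant one. -/
theorem exists_writeBinary : ∃ τ : ℕ → ℕ, PolyBd τ ∧ ∃ P : ℕ → ℕ → Prog, ∀ r b s x, r < b →
    s.reg r = un x → (∀ r', b ≤ r' → s.reg r' = []) →
    Runs (P r b) s (τ x) ⟨s.reg, x.bits.map some ++ s.out⟩ := by
  have hL : Feas (fun x : ℕ => x.bits.length) := feas_bits_length
  -- Register `b` counts the bits which remain to be written and `b + 1` those already written; the
  -- next bit and its negation are computed in unary in the registers `b + 2` and `b + 3`.
  have hbit : FeasP (fun p : ℕ × ℕ => p.2.testBit (p.2.bits.length - 1 - p.1) = true) :=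
    FeasP.testBit Feas.id.snd (hL.snd.pred.sub Feas.fst)
  have hnot := hbit.not
  obtain ⟨τL, hτL, -, PL, hPL⟩ := hL
  obtain ⟨τ₁, hτ₁, -, P₁, hP₁⟩ := hbit
  obtain ⟨τ₀, hτ₀, -, P₀, hP₀⟩ := hnot
  obtain ⟨c₁, hc₁⟩ := hτ₁.exists_mono
  obtain ⟨c₀, hc₀⟩ := hτ₀.exists_mono
  have hx : PolyBd (fun x : ℕ => x) := PolyBd.size.mono fun x => by simp
  have hxb : ∀ c, PolyBd (fun x : ℕ => (x + x + 2) ^ c) := fun c =>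
    ((hx.add hx).add (PolyBd.const 2)).pow c
  refine ⟨fun x => τL x + ((1 + x * ((x + x + 2) ^ c₁ + (x + x + 2) ^ c₀ + 8)) + (2 * x + 1)),
    hτL.add (((PolyBd.const 1).add (hx.mul (((hxb c₁).add (hxb c₀)).add (PolyBd.const 8)))).add
      (((PolyBd.const 2).mul hx).add (PolyBd.const 1))),
    fun r b => .seq (PL (fun _ => r) b) (.seq (.loop b (.seq
      (P₁ (consArg (b + 1) fun _ => r) (b + 2)) (.seq (P₀ (consArg (b + 1) fun _ => r) (b + 3))
        (.seq (.emitBit (b + 2) (b + 3)) (.push (b + 1) true)))) .skip)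
      (.clear (b + 1))), ?_⟩
  intro r b s x hr hs hfree
  set L := x.bits.length with hLdef
  have hLx : L ≤ x := by
    rw [hLdef, Nat.size_eq_bits_len, Nat.size_le]
    exact Nat.lt_two_pow_self
  have hz : ∀ j, s.reg (b + j) = [] := fun j => hfree _ (by omega)
  have k1 := hPL (fun _ => r) b s x ⟨fun i _ => ⟨hr, hs⟩, hfree⟩
  set S : ℕ → Store := fun i =>
    (⟨s.reg, (x.bits.drop (L - i)).map some ++ s.out⟩ : Store).set (b + 1) (un i) with hS
  have k2 := Runs.for_loop (r := b) (q := .skip)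
    (p := .seq (P₁ (consArg (b + 1) fun _ => r) (b + 2))
      (.seq (P₀ (consArg (b + 1) fun _ => r) (b + 3))
        (.seq (.emitBit (b + 2) (b + 3)) (.push (b + 1) true)))) L S
    (fun _ => (x + x + 2) ^ c₁ + ((x + x + 2) ^ c₀ + 7)) (fun i hi => by
      set s' := (S i).set b (un (L - i - 1)) with hs'
      have hrd : Ready s' (consArg (b + 1) fun _ => r) (b + 2) (i, x) := by
        refine ⟨fun j _ => ?_, fun r' hr' => ?_⟩
        · rcases j with _ | j
          · exact ⟨by simp [consArg], by simp [consArg, Ctx.get, hs', hS, Store.reg_set]⟩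
          · refine ⟨by simp only [consArg]; omega, ?_⟩
            simp only [consArg, hs', hS, Store.reg_set]
            rw [if_neg (by omega), if_neg (by omega)]
            exact hs
        · simp only [hs', hS, Store.reg_set]
          rw [if_neg (by omega), if_neg (by omega)]
          exact hfree r' (by omega)
      have j1 := (hP₁ _ _ _ _ hrd).mono (hc₁ (i, x) (x + x) (by simp; omega))
      set s₁ := s'.set (b + 2) (un (ind (x.testBit (x.bits.length - 1 - i) = true))) with hs₁
      have hrd' : Ready s₁ (consArg (b + 1) fun _ => r) (b + 3) (i, x) := by
        refine ⟨fun j hj => ?_, fun r' hr' => ?_⟩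
        · have h0 := hrd.1 j hj
          refine ⟨h0.1.trans (by omega), ?_⟩
          rw [hs₁, Store.reg_set_of_ne _ _ h0.1.ne]
          exact h0.2
        · rw [hs₁, Store.reg_set_of_ne _ _ (by omega)]
          exact hrd.2 r' (by omega)
      have j2 := (hP₀ _ _ _ _ hrd').mono (hc₀ (i, x) (x + x) (by simp; omega))
      have hget : x.bits.drop (L - (i + 1)) =
          x.testBit (x.bits.length - 1 - i) :: x.bits.drop (L - i) := by
        have h0 : L - (i + 1) < x.bits.length := by omega
        rw [List.drop_eq_getElem_cons h0, Nat.testBit_eq_inth,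
          List.getI_eq_getElem _ (by omega : x.bits.length - 1 - i < x.bits.length)]
        congr 2
        all_goals omega
      have z0 := hz 0
      have z2 := hz 2
      have z3 := hz 3
      rw [add_zero] at z0
      have j3 := Prog.emitBit_runs (r := b + 2) (r' := b + 3) (by omega)
        (s₁.set (b + 3) (un (ind ¬x.testBit (x.bits.length - 1 - i) = true)))
        (x.testBit (x.bits.length - 1 - i)) (by simp [hs₁, Store.reg_set]) (by simp)
      refine (j1.seq (j2.seq (j3.seq (Runs.push _ _ _)))).congr (by omega) ?_
      ext1
      · funext y
        simp only [hs₁, hs', hS, Store.reg_set]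
        split_ifs <;> first | omega | simp_all [List.replicate_succ]
      · exact (congrArg (fun l => List.map some l ++ s.out) hget).symm)
  have k3 := Prog.clear_runs (b + 1) ((S L).set b []) (n := L) (by simp [hS, Store.reg_set])
  have e0 : s.set b (un x.bits.length) = (S 0).set b (un L) := by
    have z1 := hz 1
    ext1
    · funext y
      simp only [hS, Store.reg_set]
      split_ifs <;> simp_all
    · simp [hS, Store.set, hLdef]
  rw [e0] at k1
  refine (k1.seq (k2.seq k3)).congr ?_ ?_
  · simp only [Finset.sum_const, Finset.card_range, smul_eq_mul]
    have := Nat.mul_le_mul_right ((x + x + 2) ^ c₁ + (x + x + 2) ^ c₀ + 8) hLx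
    have e : L * ((x + x + 2) ^ c₁ + ((x + x + 2) ^ c₀ + 7) + 1) =
      L * ((x + x + 2) ^ c₁ + (x + x + 2) ^ c₀ + 8) := by ring
    rw [e]
    omega
  · have z0 := hz 0
    have z1 := hz 1
    rw [add_zero] at z0
    ext1
    · funext y
      simp only [hS, Store.reg_set]
      split_ifs <;> simp_all
    · simp [hS, Store.set]

/-! ### The Turing machine which approximates the growth rate -/

/-- A program which, on a positive number `n` in binary, outputs the fraction
`approxNum t k (100 * n) / (100 * n)`. Its running time is polynomial in `2 ^ (N * N)`, where
`N = 100 * n`, and hence at most `2 ^ (C * n ^ 2)`. -/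
theorem exists_prog_approx (t k : Bool) : ∃ (p : Prog) (C : ℕ), ∀ n, 1 ≤ n →
    Runs p (⟨Function.update (fun _ => []) 0 (Computability.encodeNat n), []⟩)
      (2 ^ (C * n ^ 2))
      ⟨fun _ => [], encodeFraction (approxNum t k (100 * n) : ℤ) (100 * n)⟩ := by
  obtain ⟨F, hF, hFspec⟩ := exists_feas_approxNum t k
  have hFbd := hF.polyBd
  obtain ⟨τF, hτF, -, PF, hPF⟩ := hF
  obtain ⟨τN, hτN, -, PN, hPN⟩ := (Feas.const 100).mul Feas.id
  obtain ⟨τE, hτE, -, PE, hPE⟩ := Feas.id.mul Feas.id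
  obtain ⟨τW, hτW, W, hW⟩ := exists_writeBinary
  obtain ⟨cN, hcN⟩ := hτN.exists_mono
  have bX : PolyBd (fun p : ℕ × ℕ => p.1) := Feas.fst.polyBd
  have bN : PolyBd (fun p : ℕ × ℕ => p.2) := Feas.id.snd.polyBd
  have hσ : PolyBd (fun p : ℕ × ℕ => 20 * (p.2 + 1) * p.1 + ((p.2 + 2) ^ cN + ((2 * p.2 + 1) +
      (τE p.2 + (10 * (p.2 * p.2 + 1) * p.1 + (τF p + ((2 * p.1 + 1) + (τW p.2 + (1 +
        (τW (F p) + (1 + ((2 * p.2 + 1) + (2 * F p + 1))))))))))))) :=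
    (((PolyBd.const 20).mul (bN.add (PolyBd.const 1))).mul bX).add
    (((bN.add (PolyBd.const 2)).pow cN).add ((((PolyBd.const 2).mul bN).add (PolyBd.const 1)).add
    ((hτE.comp (by simpa using bN)).add
    ((((PolyBd.const 10).mul ((bN.mul bN).add (PolyBd.const 1))).mul bX).add
    (hτF.add ((((PolyBd.const 2).mul bX).add (PolyBd.const 1)).add
    ((hτW.comp (by simpa using bN)).add ((PolyBd.const 1).add
    ((hτW.comp (by simpa using hFbd)).add ((PolyBd.const 1).add
    ((((PolyBd.const 2).mul bN).add (PolyBd.const 1)).add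
      (((PolyBd.const 2).mul hFbd).add (PolyBd.const 1)))))))))))))
  obtain ⟨c, hc⟩ := hσ
  -- Registers: `2` holds `n`, `3` holds `N`, `4` holds `N * N`, `5` holds `X = 2 ^ (N * N)`, and `6`
  -- holds the numerator `b`. The output is pushed on a stack, hence the denominator comes first and
  -- the sign last. The exponent is `3 * 100 ^ 2 * c`, since the size of `(X, N)` is at most `X ^ 3`.
  refine ⟨.seq .readBinary (.seq (PN (fun _ => 2) 3) (.seq (.clear 2) (.seq (PE (fun _ => 3) 4)
    (.seq (.twoPow 4) (.seq (PF (consArg 5 fun _ => 3) 6) (.seq (.clear 5) (.seq (W 3 7)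
    (.seq (.emit none) (.seq (W 6 7) (.seq (.emit (some false))
      (.seq (.clear 3) (.clear 6)))))))))))), 30000 * c, fun n hn => ?_⟩
  set N := 100 * n with hN
  set X := 2 ^ (N * N) with hX
  have hFb : F (X, N) = approxNum t k N := hFspec N (by omega)
  rw [← hFb]
  set b := F (X, N) with hb
  have k1 := Prog.readBinary_runs n
  have k2 := hPN (fun _ => 2) 3 ((Store.empty []).set 2 (un n)) n
    ⟨fun i _ => ⟨by norm_num, by simp [Ctx.get]⟩, fun r hr => by
      rw [Store.reg_set_of_ne _ _ (by omega)]; rfl⟩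
  have k3 := Prog.clear_runs 2 (((Store.empty []).set 2 (un n)).set 3 (un N)) (n := n)
    (by simp [Store.reg_set])
  have e3 : (((Store.empty []).set 2 (un n)).set 3 (un N)).set 2 [] =
      (Store.empty []).set 3 (un N) := by
    rw [Store.set_comm _ (by decide : 3 ≠ 2), Store.set_set,
      Store.set_eq_self (r := 2) _ (show (Store.empty []).reg 2 = [] from rfl)]
  rw [e3] at k3
  have k4 := hPE (fun _ => 3) 4 ((Store.empty []).set 3 (un N)) N
    ⟨fun i _ => ⟨by norm_num, by simp [Ctx.get]⟩, fun r hr => by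
      rw [Store.reg_set_of_ne _ _ (by omega)]; rfl⟩
  have k5 := Prog.twoPow_runs 4 (((Store.empty []).set 3 (un N)).set 4 (un (N * N))) (e := N * N)
    (by simp) (by simp [Store.reg_set]) (by simp [Store.reg_set])
  have e5 : ((((Store.empty []).set 3 (un N)).set 4 (un (N * N))).set 4 []).set (4 + 1)
      (un (2 ^ (N * N))) = ((Store.empty []).set 3 (un N)).set 5 (un X) := by
    rw [Store.set_set, Store.set_eq_self (r := 4) _ (by simp [Store.reg_set])]
  rw [e5] at k5
  have k6 := hPF (consArg 5 fun _ => 3) 6 (((Store.empty []).set 3 (un N)).set 5 (un X)) (X, N)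
    ⟨fun i _ => by
      rcases i with _ | i
      · exact ⟨by norm_num [consArg], by simp [consArg, Ctx.get]⟩
      · exact ⟨by norm_num [consArg], by simp [consArg, Ctx.get, Store.reg_set]⟩, fun r hr => by
      rw [Store.reg_set_of_ne _ _ (by omega), Store.reg_set_of_ne _ _ (by omega)]; rfl⟩
  have k7 := Prog.clear_runs 5 ((((Store.empty []).set 3 (un N)).set 5 (un X)).set 6 (un b))
    (n := X) (by simp [Store.reg_set])
  set D : List (Option Bool) → Store := fun o => ((Store.empty o).set 3 (un N)).set 6 (un b)
    with hD
  have e7 : ((((Store.empty []).set 3 (un N)).set 5 (un X)).set 6 (un b)).set 5 [] = D [] := by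
    rw [Store.set_comm _ (by decide : 6 ≠ 5), Store.set_set,
      Store.set_eq_self (r := 5) _ (by simp [Store.reg_set])]
  rw [e7] at k7
  have hDfree : ∀ o r, 7 ≤ r → (D o).reg r = [] := fun o r hr => by
    rw [hD, Store.reg_set_of_ne _ _ (by omega), Store.reg_set_of_ne _ _ (by omega)]
    rfl
  have hD3 : ∀ o, (D o).reg 3 = un N := fun o => by simp [hD, Store.reg_set]
  have hD6 : ∀ o, (D o).reg 6 = un b := fun o => by simp [hD]
  have k8 := hW 3 7 (D []) N (by norm_num) (hD3 _) (hDfree _)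
  set o₁ : List (Option Bool) := N.bits.map some ++ [] with ho₁
  have k9 : Runs (.emit none) (D o₁) 1 (D (none :: o₁)) := ⟨1, le_rfl, .emit none _⟩
  have k10 := hW 6 7 (D (none :: o₁)) b (by norm_num) (hD6 _) (hDfree _)
  set o₂ : List (Option Bool) := b.bits.map some ++ none :: o₁ with ho₂
  have k11 : Runs (.emit (some false)) (D o₂) 1 (D (some false :: o₂)) :=
    ⟨1, le_rfl, .emit (some false) _⟩
  have k12 := Prog.clear_runs 3 (D (some false :: o₂)) (hD3 _)
  have k13 := Prog.clear_runs 6 ((D (some false :: o₂)).set 3 []) (n := b) (by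
    rw [Store.reg_set_of_ne _ _ (by decide), hD6])
  have hout : encodeFraction (b : ℤ) N = some false :: o₂ := by
    simp [encodeFraction, encodeNat_eq_bits, ho₂, ho₁]
  rw [encodeNat_eq_bits, hout]
  refine (k1.seq (k2.seq (k3.seq (k4.seq (k5.seq (k6.seq (k7.seq (k8.seq (k9.seq (k10.seq
    (k11.seq (k12.seq k13)))))))))))).congr ?_ ?_
  · have hXN : N ≤ X := (Nat.le_mul_self N).trans Nat.lt_two_pow_self.le
    have h2n : 2 ^ n ≤ X := Nat.pow_le_pow_right two_pos (by nlinarith)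
    have hX2 : 2 ≤ X := by
      calc 2 = 2 ^ 1 := rfl
        _ ≤ X := Nat.pow_le_pow_right two_pos (by nlinarith)
    have m1 : 20 * (n + 1) * 2 ^ n ≤ 20 * (N + 1) * X :=
      Nat.mul_le_mul (by omega) h2n
    have m2 : τN n ≤ (N + 2) ^ cN := hcN n N (by simp; omega)
    have m3 := hc (X, N)
    have m4 : Ctx.size ((X, N) : ℕ × ℕ) + 2 ≤ X ^ 3 := by
      simp only [Ctx.size_prod, Ctx.size_nat]
      nlinarith [Nat.mul_le_mul hX2 hX2, Nat.mul_le_mul (Nat.mul_le_mul hX2 hX2) (le_refl X)]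
    have m5 : (X ^ 3) ^ c = 2 ^ (30000 * c * n ^ 2) := by
      rw [hX, ← pow_mul, ← pow_mul]
      congr 1
      rw [hN]
      ring
    have m6 := m3.trans ((Nat.pow_le_pow_left m4 c).trans m5.le)
    dsimp only at m6
    refine le_trans ?_ m6
    exact Nat.add_le_add m1 (Nat.add_le_add m2 (Nat.add_le_add (by omega) le_rfl))
  · ext1
    · funext x
      simp only [hD, Store.reg_set, Store.reg_empty]
      split_ifs <;> rfl
    · rfl

theorem computable_two_pow_mul_sq (C : ℕ) : Computable (fun n : ℕ => 2 ^ (C * n ^ 2)) := by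
  have h1 : Primrec (fun n : ℕ => C * n ^ 2) :=
    (Primrec.nat_mul.comp (Primrec.const C) (Primrec.nat_mul.comp Primrec.id Primrec.id)).of_eq
      fun n => by simp [sq]
  have h2 : Primrec (fun n : ℕ => 2 ^ n) := by
    refine (Primrec.nat_rec₁ 1 (Primrec.nat_mul.comp (Primrec.const 2)
      (Primrec.snd (α := ℕ))).to₂).of_eq fun n => ?_
    induction n with
    | zero => rfl
    | succ n ih => rw [pow_succ, ← ih, mul_comm]
  exact (h2.comp h1).to_comp

theorem computableWithRate_growthRate (t k : Bool) :
    ComputableWithRateTwoPowBigOSq (2 ^ limitDensity t k) := by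
  obtain ⟨p, C, hp⟩ := exists_prog_approx t k
  obtain ⟨R, hR⟩ := p.exists_regsLE
  refine ⟨fun n => 2 ^ (C * n ^ 2), ⟨C, Filter.Eventually.of_forall fun _ => le_rfl⟩,
    computable_two_pow_mul_sq C, Prog.machineAux R p, fun n hn => ?_⟩
  obtain ⟨s, hs, he⟩ := hp n hn
  refine ⟨approxNum t k (100 * n), 100 * n, by omega, ?_, Prog.machine_outputs hR hs he⟩
  rw [Int.cast_natCast]
  exact abs_sub_approxNum_div_le t k hn

end GridDomination

theorem mainTheorem2 :
    ∃ νD νT νM νMT : ℝ,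
      (GridDomination.HasGrowthRate GridDomination.numD νD ∧
        GridDomination.HasGrowthRate GridDomination.numT νT ∧
        GridDomination.HasGrowthRate GridDomination.numM νM ∧
        GridDomination.HasGrowthRate GridDomination.numMT νMT) ∧
      GridDomination.ComputableWithRateTwoPowBigOSq νD ∧
      GridDomination.ComputableWithRateTwoPowBigOSq νT ∧
      GridDomination.ComputableWithRateTwoPowBigOSq νM ∧
      GridDomination.ComputableWithRateTwoPowBigOSq νMT := by
  open GridDomination in
  exact ⟨_, _, _, _, ⟨hasGrowthRate_of_eq numD_eq, hasGrowthRate_of_eq numT_eq,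
    hasGrowthRate_of_eq numM_eq, hasGrowthRate_of_eq numMT_eq⟩,
    computableWithRate_growthRate _ _, computableWithRate_growthRate _ _,
    computableWithRate_growthRate _ _, computableWithRate_growthRate _ _⟩
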